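/- **Theorem 3.6.** Let $\mathcal G\rightrightarrows M$ be a Lie groupoid: a groupoid with source $s$ and target $t$ (the product $gh$ is defined when $s(g)=t(h)$) such that $\mathcal G$ and $M$ are smooth (finite-dimensional, Hausdorff, boundaryless) manifolds, $s,t$, the unit map $p\mapsto e_p$, the inversion and the multiplication are smooth, and $s$ is a surjective submersion. For $g\in\mathcal G$ let $l_g:t^{-1}(s(g))\to t^{-1}(t(g))$, $h\mapsto gh$. Put $T^t\mathcal G=\ker t_*$, whose restriction to a fiber $t^{-1}(p)$ is the tangent bundle of $t^{-1}(p)$, and let $A\mathcal G\to M$ be the Lie algebroid of $\mathcal G$: its fiber at $p$ is $(A\mathcal G)_p=(T^t\mathcal G)_{e_p}$, its anchor is $\rho=s_*|_{A\mathcal G}:A\mathcal G\to TM$, and the bracket of $X,Y\in\Gamma(A\mathcal G)$ is $[X,Y]_p=[\widetilde X,\widetilde Y]_{e_p}$, where $\widetilde X_g=(l_g)_{*,e_{s(g)}}X_{s(g)}$. For $\omega\in\Gamma(\wedge^2(A\mathcal G)^*)$ and $X,Y,Z\in\Gamma(A\mathcal G)$ let $$(d_{A\mathcal G}\,\omega)(X,Y,Z)=\rho(X)[\omega(Y,Z)]-\rho(Y)[\omega(X,Z)]+\rho(Z)[\omega(X,Y)]-\omega([X,Y],Z)+\omega([X,Z],Y)-\omega([Y,Z],X).$$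 A *quasi-Frobenius structure* on $A\mathcal G$ is a section $\omega\in\Gamma(\wedge^2(A\mathcal G)^*)$ that is nondegenerate on every fiber and satisfies $d_{A\mathcal G}\,\omega=0$. Let $\Gamma_L(\wedge^2(T^t\mathcal G)^*)$ be the vector space of smooth sections $\widetilde\omega$ of $\wedge^2(T^t\mathcal G)^*$ that are left-invariant, that is, $(l_g)^*\big(\widetilde\omega|_{t^{-1}(t(g))}\big)=\widetilde\omega|_{t^{-1}(s(g))}$ for all $g\in\mathcal G$. A *$t$-symplectic form* on $\mathcal G\rightrightarrows M$ is an $\widetilde\omega\in\Gamma_L(\wedge^2(T^t\mathcal G)^*)$ such that $(t^{-1}(p),\widetilde\omega|_{t^{-1}(p)})$ is a symplectic manifold for every $p\in M$. Then restriction to the units, $$\varphi:\Gamma_L(\wedge^2(T^t\mathcal G)^*)\to\Gamma(\wedge^2(A\mathcal G)^*),\qquad \varphi(\widetilde\omega)_p=\widetilde\omega_{e_p},$$ is a well-defined isomorphism of real vector spaces; an element $\widetilde\omega\in\Gamma_L(\wedge^2(T^t\mathcal G)^*)$ is a $t$-symplectic form if and only if $\varphi(\widetilde\omega)$ is a quasi-Frobenius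 structure on $A\mathcal G$; and hence $\varphi$ restricts to a bijection from the set of $t$-symplectic forms on $\mathcal G\rightrightarrows M$ onto the set of quasi-Frobenius structures on $A\mathcal G$. -/

import Mathlib

open Set Function Manifold
open scoped Manifold ContDiff Topology

noncomputable section

section SubmersionFiber

universe u

variable {E : Type u} [NormedAddCommGroup E] [NormedSpace ℝ E] {H : Type*} [TopologicalSpace H]
  {I : ModelWithCorners ℝ E H}
  {E' : Type*} [NormedAddCommGroup E'] [NormedSpace ℝ E'] {H' : Type*} [TopologicalSpace H']
  {J : ModelWithCorners ℝ E' H'}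
  {M : Type*} [TopologicalSpace M] [ChartedSpace H M]
  {N : Type*} [TopologicalSpace N] [ChartedSpace H' N] {f : M → N}

/-- The vertical tangent space `ker f_{*,x}` of a map `f` at a point `x`. -/
def verticalSpace (I : ModelWithCorners ℝ E H) (J : ModelWithCorners ℝ E' H') (f : M → N) (x : M) :
    Submodule ℝ (TangentSpace I x) :=
  LinearMap.ker (mfderiv I J f x : TangentSpace I x →ₗ[ℝ] TangentSpace J (f x))

/-- The fibre `f ⁻¹ {y}` of a submersion `f`, equipped below with the structure of an embedded
submanifold. -/
structure SubmersionFiber (hf : IsSubmersion I J ∞ f) (y : N) where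
  /-- The inclusion of a fibre into the total space. -/
  incl : M
  map_incl : f incl = y

namespace SubmersionFiber

variable {hf : IsSubmersion I J ∞ f} {y : N}

instance : TopologicalSpace (SubmersionFiber hf y) := TopologicalSpace.induced incl inferInstance

lemma isInducing_incl : Topology.IsInducing (incl : SubmersionFiber hf y → M) := ⟨rfl⟩

lemma incl_injective : Injective (incl : SubmersionFiber hf y → M) := by
  rintro ⟨a, _⟩ ⟨b, _⟩ h
  congr

/-- A normal form of `f` at `x`. -/
lemma normalForm (hf : IsSubmersion I J ∞ f) (x : M) :
    IsSubmersionAtOfComplement hf.complement I J ∞ f x :=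
  hf.isSubmersionOfComplement_complement x

/-- In the submersion chart at `x`, the coordinate along the fibre. -/
def coord (hf : IsSubmersion I J ∞ f) (x z : M) : hf.complement :=
  ((normalForm hf x).equiv ((normalForm hf x).domChart.extend I z)).2

/-- In the submersion chart at `x`, the point with given value of `f` and given coordinate along
the fibre. -/
def point (hf : IsSubmersion I J ∞ f) (x : M) (y : N) (v : hf.complement) : M :=
  ((normalForm hf x).domChart.extend I).symm
    ((normalForm hf x).equiv.symm ((normalForm hf x).codChart.extend J y, v))

/-- The domain of definition of `point`. -/
def pointDomain (hf : IsSubmersion I J ∞ f) (x : M) : Set (N × hf.complement) :=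
  {p | p.1 ∈ (normalForm hf x).codChart.source ∧
    (normalForm hf x).equiv.symm ((normalForm hf x).codChart.extend J p.1, p.2) ∈
      ((normalForm hf x).domChart.extend I).target}

lemma equiv_fst (x : M) {z : M} (hz : z ∈ (normalForm hf x).domChart.source) :
    ((normalForm hf x).equiv ((normalForm hf x).domChart.extend I z)).1 =
      (normalForm hf x).codChart.extend J (f z) := by
  have h := (normalForm hf x).writtenInCharts
    (((normalForm hf x).domChart.extend I).map_source (by simpa using hz))
  simp only [comp_apply] at h
  rw [← h, OpenPartialHomeomorph.extend_left_inv _ hz]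

lemma point_mem_source {x : M} {p : N × hf.complement} (hp : p ∈ pointDomain hf x) :
    point hf x p.1 p.2 ∈ (normalForm hf x).domChart.source := by
  have := ((normalForm hf x).domChart.extend I).map_target hp.2
  simpa [point] using this

lemma extend_point {x : M} {p : N × hf.complement} (hp : p ∈ pointDomain hf x) :
    (normalForm hf x).domChart.extend I (point hf x p.1 p.2) =
      (normalForm hf x).equiv.symm ((normalForm hf x).codChart.extend J p.1, p.2) :=
  ((normalForm hf x).domChart.extend I).right_inv hp.2

lemma map_point {x : M} {p : N × hf.complement} (hp : p ∈ pointDomain hf x) :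
    f (point hf x p.1 p.2) = p.1 := by
  have h1 := equiv_fst x (point_mem_source hp)
  rw [extend_point hp, ContinuousLinearEquiv.apply_symm_apply] at h1
  have h2 := (normalForm hf x).source_subset_preimage_source (point_mem_source hp)
  exact (((normalForm hf x).codChart.extend J).injOn (by simpa using hp.1) (by simpa using h2)
    h1).symm

lemma coord_point {x : M} {p : N × hf.complement} (hp : p ∈ pointDomain hf x) :
    coord hf x (point hf x p.1 p.2) = p.2 := by
  rw [coord, extend_point hp, ContinuousLinearEquiv.apply_symm_apply]

lemma equiv_symm_coord {x z : M} (hz : z ∈ (normalForm hf x).domChart.source) :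
    (normalForm hf x).equiv.symm ((normalForm hf x).codChart.extend J (f z), coord hf x z) =
      (normalForm hf x).domChart.extend I z := by
  rw [← equiv_fst x hz, coord]
  simp

lemma mem_pointDomain {x z : M} (hz : z ∈ (normalForm hf x).domChart.source) :
    (f z, coord hf x z) ∈ pointDomain hf x := by
  refine ⟨(normalForm hf x).source_subset_preimage_source hz, ?_⟩
  simp only [equiv_symm_coord hz]
  exact ((normalForm hf x).domChart.extend I).map_source (by simpa using hz)

lemma point_coord {x z : M} (hz : z ∈ (normalForm hf x).domChart.source) :
    point hf x (f z) (coord hf x z) = z := by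
  rw [point, equiv_symm_coord hz]
  exact OpenPartialHomeomorph.extend_left_inv _ hz

lemma isOpen_pointDomain [I.Boundaryless] (x : M) : IsOpen (pointDomain hf x) := by
  have hc : ContinuousOn (fun p : N × hf.complement ↦
      (normalForm hf x).equiv.symm ((normalForm hf x).codChart.extend J p.1, p.2))
      {p | p.1 ∈ (normalForm hf x).codChart.source} := by
    refine (normalForm hf x).equiv.symm.continuous.comp_continuousOn ?_
    refine ContinuousOn.prodMk ?_ continuousOn_snd
    have := OpenPartialHomeomorph.continuousOn_extend (I := J) (normalForm hf x).codChart
    exact this.comp continuousOn_fst (fun p hp ↦ by simpa using hp)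
  exact hc.isOpen_inter_preimage
    ((normalForm hf x).codChart.open_source.preimage continuous_fst)
    (OpenPartialHomeomorph.isOpen_extend_target _)

lemma contMDiffOn_coord (x : M) :
    ContMDiffOn I 𝓘(ℝ, hf.complement) ∞ (coord hf x) (normalForm hf x).domChart.source := by
  have h1 := OpenPartialHomeomorph.contMDiffOn_extend
    (normalForm hf x).domChart_mem_maximalAtlas
  have h2 : ContDiff ℝ ∞ (fun w ↦ ((normalForm hf x).equiv w).2) :=
    contDiff_snd.comp (normalForm hf x).equiv.contDiff
  exact h2.contMDiff.comp_contMDiffOn h1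

lemma contMDiffOn_point [I.Boundaryless] (x : M) :
    ContMDiffOn (J.prod 𝓘(ℝ, hf.complement)) I ∞ (fun p ↦ point hf x p.1 p.2)
      (pointDomain hf x) := by
  have h0 := contMDiffOn_extend_symm (normalForm hf x).domChart_mem_maximalAtlas
  rw [← OpenPartialHomeomorph.extend_target'] at h0
  refine h0.comp ?_ (fun p hp ↦ hp.2)
  have h1 := OpenPartialHomeomorph.contMDiffOn_extend
    (normalForm hf x).codChart_mem_maximalAtlas
  have h2 : ContMDiffOn (J.prod 𝓘(ℝ, hf.complement)) (𝓘(ℝ, E' × hf.complement)) ∞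
      (fun p : N × hf.complement ↦ ((normalForm hf x).codChart.extend J p.1, p.2))
      (pointDomain hf x) :=
    (h1.comp contMDiffOn_fst (fun p hp ↦ hp.1)).prodMk_space contMDiffOn_snd
  exact (normalForm hf x).equiv.symm.contDiff.contMDiff.comp_contMDiffOn h2

lemma contMDiffOn_point_right [I.Boundaryless] (x : M) (y : N) :
    ContMDiffOn 𝓘(ℝ, hf.complement) I ∞ (point hf x y) ((fun v ↦ (y, v)) ⁻¹' pointDomain hf x) :=
  (contMDiffOn_point x).comp (f := fun v ↦ (y, v))
    (contMDiff_const.prodMk contMDiff_id).contMDiffOn (mapsTo_preimage _ _)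

open Classical in
/-- The point of a fibre with given coordinate along the fibre in the submersion chart at `x`. -/
def fiberPoint (x : SubmersionFiber hf y) (v : hf.complement) : SubmersionFiber hf y :=
  if hv : (y, v) ∈ pointDomain hf x.incl then ⟨point hf x.incl y v, map_point hv⟩ else x

lemma incl_fiberPoint {x : SubmersionFiber hf y} {v : hf.complement}
    (hv : (y, v) ∈ pointDomain hf x.incl) : (fiberPoint x v).incl = point hf x.incl y v := by
  rw [fiberPoint, dif_pos hv]

lemma mem_pointDomain_incl {x : M} {z : SubmersionFiber hf y}
    (hz : z.incl ∈ (normalForm hf x).domChart.source) :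
    (y, coord hf x z.incl) ∈ pointDomain hf x := by
  have := mem_pointDomain hz
  rwa [z.map_incl] at this

lemma point_coord_incl {x : M} {z : SubmersionFiber hf y}
    (hz : z.incl ∈ (normalForm hf x).domChart.source) :
    point hf x y (coord hf x z.incl) = z.incl := by
  have := point_coord hz
  rwa [z.map_incl] at this

/-- The chart of a fibre induced by a submersion chart of the total space at a point `x`. -/
def chart [I.Boundaryless] (x : SubmersionFiber hf y) :
    OpenPartialHomeomorph (SubmersionFiber hf y) hf.complement where
  toFun z := coord hf x.incl z.incl
  invFun := fiberPoint x
  source := incl ⁻¹' (normalForm hf x.incl).domChart.source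
  target := (fun v ↦ (y, v)) ⁻¹' pointDomain hf x.incl
  map_source' _ hz := mem_pointDomain_incl hz
  map_target' v hv := by
    rw [mem_preimage, incl_fiberPoint hv]
    exact point_mem_source (p := (y, v)) hv
  left_inv' z hz := by
    apply incl_injective
    rw [incl_fiberPoint (mem_pointDomain_incl hz)]
    exact point_coord_incl hz
  right_inv' v hv := by
    rw [incl_fiberPoint hv]
    exact coord_point (p := (y, v)) hv
  open_source := (normalForm hf x.incl).domChart.open_source.preimage isInducing_incl.continuous
  open_target := (isOpen_pointDomain x.incl).preimage (Continuous.prodMk_right y)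
  continuousOn_toFun :=
    ContinuousOn.comp (g := coord hf x.incl) (f := incl) (contMDiffOn_coord x.incl).continuousOn
      isInducing_incl.continuous.continuousOn (mapsTo_preimage _ _)
  continuousOn_invFun := by
    rw [isInducing_incl.continuousOn_iff]
    have h := (contMDiffOn_point_right (hf := hf) x.incl y).continuousOn
    exact h.congr (fun v hv ↦ incl_fiberPoint hv)

lemma chart_apply [I.Boundaryless] (x z : SubmersionFiber hf y) :
    chart x z = coord hf x.incl z.incl := rfl

lemma mem_chart_source [I.Boundaryless] {x z : SubmersionFiber hf y} :
    z ∈ (chart x).source ↔ z.incl ∈ (normalForm hf x.incl).domChart.source := Iff.rfl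

lemma incl_chart_symm [I.Boundaryless] {x : SubmersionFiber hf y} {v : hf.complement}
    (hv : v ∈ (chart x).target) : ((chart x).symm v).incl = point hf x.incl y v :=
  incl_fiberPoint hv

instance [I.Boundaryless] : ChartedSpace hf.complement (SubmersionFiber hf y) where
  atlas := range chart
  chartAt := chart
  mem_chart_source x := (normalForm hf x.incl).mem_domChart_source
  chart_mem_atlas := mem_range_self

lemma chartAt_eq [I.Boundaryless] (x : SubmersionFiber hf y) :
    chartAt hf.complement x = chart x := rfl

instance [I.Boundaryless] : IsManifold 𝓘(ℝ, hf.complement) ∞ (SubmersionFiber hf y) := by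
  refine isManifold_of_contDiffOn _ _ _ ?_
  rintro _ _ ⟨x, rfl⟩ ⟨x', rfl⟩
  rw [← contMDiffOn_iff_contDiffOn]
  have h1 : ContMDiffOn 𝓘(ℝ, hf.complement) 𝓘(ℝ, hf.complement) ∞
      (fun v ↦ coord hf x'.incl (point hf x.incl y v))
      ((chart x).target ∩ (chart x).symm ⁻¹' (chart x').source) := by
    refine (contMDiffOn_coord x'.incl).comp
      ((contMDiffOn_point_right x.incl y).mono inter_subset_left) ?_
    rintro v ⟨hv, hv'⟩
    rw [mem_preimage, mem_chart_source, incl_chart_symm hv] at hv'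
    exact hv'
  refine (h1.congr ?_).mono ?_
  · rintro v ⟨hv, hv'⟩
    simp [chart_apply, incl_chart_symm hv]
  · intro v hv
    simpa using hv

lemma contMDiff_incl [I.Boundaryless] :
    ContMDiff 𝓘(ℝ, hf.complement) I ∞ (incl : SubmersionFiber hf y → M) := by
  intro x
  have hx : x ∈ (chart x).source := (normalForm hf x.incl).mem_domChart_source
  have h1 : ContMDiffOn 𝓘(ℝ, hf.complement) 𝓘(ℝ, hf.complement) ∞ (chart x) (chart x).source :=
    contMDiffOn_chart (x := x)
  have h2 := (contMDiffOn_point_right (hf := hf) x.incl y).comp h1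
    (fun z hz ↦ (chart x).map_source hz)
  refine (h2.congr (fun z hz ↦ ?_)).contMDiffAt ((chart x).open_source.mem_nhds hx)
  rw [comp_apply, ← incl_chart_symm ((chart x).map_source hz), (chart x).left_inv hz]


lemma mdifferentiableAt_incl [I.Boundaryless] (x : SubmersionFiber hf y) :
    MDifferentiableAt 𝓘(ℝ, hf.complement) I incl x :=
  contMDiff_incl.mdifferentiableAt (by simp)

lemma mfderiv_incl_mem [I.Boundaryless] (x : SubmersionFiber hf y)
    (v : TangentSpace 𝓘(ℝ, hf.complement) x) :
    mfderiv 𝓘(ℝ, hf.complement) I incl x v ∈ verticalSpace I J f x.incl := by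
  have h1 : MDifferentiableAt I J f x.incl := hf.contMDiff.mdifferentiableAt (by simp)
  have h2 := mfderiv_comp x h1 (mdifferentiableAt_incl x)
  have h3 : f ∘ (incl : SubmersionFiber hf y → M) = fun _ ↦ y := funext fun z ↦ z.map_incl
  rw [h3, mfderiv_const] at h2
  exact (DFunLike.congr_fun h2 v).symm

/-- The derivative of the inclusion of a fibre, as a map into the vertical tangent space. -/
def inclDeriv [I.Boundaryless] (x : SubmersionFiber hf y) :
    TangentSpace 𝓘(ℝ, hf.complement) x →L[ℝ] verticalSpace I J f x.incl :=
  (mfderiv 𝓘(ℝ, hf.complement) I incl x).codRestrict _ (mfderiv_incl_mem x)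

lemma coe_inclDeriv [I.Boundaryless] (x : SubmersionFiber hf y)
    (v : TangentSpace 𝓘(ℝ, hf.complement) x) :
    (inclDeriv x v : TangentSpace I x.incl) = mfderiv 𝓘(ℝ, hf.complement) I incl x v := rfl

lemma inclDeriv_injective [I.Boundaryless] [IsManifold I ∞ M] (x : SubmersionFiber hf y) :
    Injective (inclDeriv x) := by
  rw [injective_iff_map_eq_zero]
  intro v hv
  have hv' : mfderiv 𝓘(ℝ, hf.complement) I incl x v = 0 := by
    rw [← coe_inclDeriv, hv]; rfl
  have hx := (normalForm hf x.incl).mem_domChart_source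
  have h1 : MDifferentiableAt I 𝓘(ℝ, hf.complement) (coord hf x.incl) x.incl :=
    ((contMDiffOn_coord x.incl).contMDiffAt
      ((normalForm hf x.incl).domChart.open_source.mem_nhds hx)).mdifferentiableAt (by simp)
  have h4 : mfderiv 𝓘(ℝ, hf.complement) 𝓘(ℝ, hf.complement) (chartAt hf.complement x) x v = 0 := by
    refine (mfderiv_comp_apply x h1 (mdifferentiableAt_incl x) v).trans ?_
    rw [hv', map_zero]
    rfl
  have h5 : (mfderiv 𝓘(ℝ, hf.complement) 𝓘(ℝ, hf.complement) (extChartAt 𝓘(ℝ, hf.complement) x)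
      x).IsInvertible := isInvertible_mfderiv_extChartAt (mem_extChartAt_source x)
  have h6 : (extChartAt 𝓘(ℝ, hf.complement) x : SubmersionFiber hf y → hf.complement) =
      chartAt hf.complement x := by ext z; simp
  rw [h6] at h5
  exact (injective_iff_map_eq_zero _).1 h5.injective v h4

lemma inclDeriv_surjective [I.Boundaryless] [IsManifold I ∞ M] (x : SubmersionFiber hf y) :
    Surjective (inclDeriv x) := by
  obtain ⟨x, rfl⟩ := x
  set x' : SubmersionFiber hf (f x) := ⟨x, rfl⟩ with hx'
  rintro ⟨v, hv⟩
  have hv : mfderiv I J f x v = 0 := hv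
  have hx : x ∈ (normalForm hf x).domChart.source := (normalForm hf x).mem_domChart_source
  have hη : MDifferentiableAt I 𝓘(ℝ, hf.complement) (coord hf x) x :=
    ((contMDiffOn_coord x).contMDiffAt
      ((normalForm hf x).domChart.open_source.mem_nhds hx)).mdifferentiableAt (by simp)
  have hff : MDifferentiableAt I J f x := hf.contMDiff.mdifferentiableAt (by simp)
  have hP : MDifferentiableAt (J.prod 𝓘(ℝ, hf.complement)) I (fun p ↦ point hf x p.1 p.2)
      (f x, coord hf x x) :=
    ((contMDiffOn_point x).contMDiffAt
      ((isOpen_pointDomain x).mem_nhds (mem_pointDomain hx))).mdifferentiableAt (by simp)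
  have e1 : (fun p ↦ point hf x p.1 p.2) ∘ (fun z ↦ (f z, coord hf x z)) =ᶠ[𝓝 x] id := by
    filter_upwards [(normalForm hf x).domChart.open_source.mem_nhds hx] with z hz
    exact point_coord hz
  have d1 : mfderiv (J.prod 𝓘(ℝ, hf.complement)) I (fun p ↦ point hf x p.1 p.2) (f x, coord hf x x)
      (mfderiv I (J.prod 𝓘(ℝ, hf.complement)) (fun z ↦ (f z, coord hf x z)) x v) = v := by
    refine (mfderiv_comp_apply x hP (hff.prodMk hη) v).symm.trans ?_
    exact (DFunLike.congr_fun e1.mfderiv_eq v).trans (DFunLike.congr_fun mfderiv_id v)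
  have hc : MDifferentiableAt 𝓘(ℝ, hf.complement) (J.prod 𝓘(ℝ, hf.complement))
      (fun u ↦ (f x, u)) (coord hf x x) :=
    mdifferentiableAt_const.prodMk mdifferentiableAt_id
  have ht : coord hf x x ∈ (chart x').target := (chart x').map_source (x := x') hx
  have hsymm : MDifferentiableAt 𝓘(ℝ, hf.complement) 𝓘(ℝ, hf.complement) (chart x').symm
      (coord hf x x) := by
    have := contMDiffOn_chart_symm (I := 𝓘(ℝ, hf.complement)) (n := ∞) (x := x')
    exact (this.contMDiffAt ((chart x').open_target.mem_nhds ht)).mdifferentiableAt (by simp)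
  have e2 : incl ∘ (chart x').symm =ᶠ[𝓝 (coord hf x x)]
      (fun p ↦ point hf x p.1 p.2) ∘ (fun u ↦ (f x, u)) := by
    filter_upwards [(chart x').open_target.mem_nhds ht] with u hu
    exact incl_chart_symm hu
  have hxx : (chart x').symm (coord hf x x) = x' := (chart x').left_inv (x := x') hx
  set w : hf.complement := mfderiv I 𝓘(ℝ, hf.complement) (coord hf x) x v with hw
  have d3 : mfderiv 𝓘(ℝ, hf.complement) I incl x'
      (mfderiv 𝓘(ℝ, hf.complement) 𝓘(ℝ, hf.complement) (chart x').symm (coord hf x x) w) =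
      mfderiv (J.prod 𝓘(ℝ, hf.complement)) I (fun p ↦ point hf x p.1 p.2) (f x, coord hf x x)
      (mfderiv 𝓘(ℝ, hf.complement) (J.prod 𝓘(ℝ, hf.complement)) (fun u ↦ (f x, u))
        (coord hf x x) w) := by
    refine Eq.trans ?_ (mfderiv_comp_apply (coord hf x x) hP hc w)
    refine Eq.trans ?_ (DFunLike.congr_fun
      (e2.mfderiv_eq (I := 𝓘(ℝ, hf.complement)) (I' := I)) w)
    exact (mfderiv_comp_apply_of_eq _ (mdifferentiableAt_incl x') hsymm hxx w).symm
  refine ⟨mfderiv 𝓘(ℝ, hf.complement) 𝓘(ℝ, hf.complement) (chart x').symm (coord hf x x) w, ?_⟩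
  apply Subtype.ext
  refine Eq.trans d3 (Eq.trans (congrArg _ ?_) d1)
  have p1 : mfderiv I (J.prod 𝓘(ℝ, hf.complement)) (fun z ↦ (f z, coord hf x z)) x v =
      ((0, w) : E' × hf.complement) :=
    (DFunLike.congr_fun (mfderiv_prodMk hff hη) v).trans (Prod.ext hv rfl)
  have p2 : mfderiv 𝓘(ℝ, hf.complement) (J.prod 𝓘(ℝ, hf.complement)) (fun u ↦ (f x, u))
      (coord hf x x) w = ((0, w) : E' × hf.complement) := by
    refine (DFunLike.congr_fun (mfderiv_prodMk (I := 𝓘(ℝ, hf.complement)) (I' := J)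
      (f := fun _ ↦ f x) (g := fun u ↦ u) mdifferentiableAt_const mdifferentiableAt_id) w).trans ?_
    refine Prod.ext ?_ ?_
    · exact DFunLike.congr_fun (mfderiv_const (I := 𝓘(ℝ, hf.complement)) (I' := J)
        (c := f x) (x := coord hf x x)) w
    · exact DFunLike.congr_fun (mfderiv_id (I := 𝓘(ℝ, hf.complement)) (x := coord hf x x)) w
  exact p2.trans p1.symm

/-- The tangent space of a fibre is the vertical tangent space. -/
def tangentEquiv [I.Boundaryless] [IsManifold I ∞ M] (x : SubmersionFiber hf y) :
    TangentSpace 𝓘(ℝ, hf.complement) x ≃ₗ[ℝ] verticalSpace I J f x.incl :=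
  LinearEquiv.ofBijective (inclDeriv x).toLinearMap
    ⟨inclDeriv_injective x, inclDeriv_surjective x⟩

end SubmersionFiber

/-- The Lie bracket of two vertical vector fields is vertical. -/
lemma mlieBracket_mem_verticalSpace [CompleteSpace E] [IsManifold I ∞ M] [IsManifold J ∞ N]
    (hf : ContMDiff I J ∞ f) {V W : Π x : M, TangentSpace I x} {x : M}
    (hV : MDifferentiableAt I I.tangent (fun x ↦ (⟨x, V x⟩ : TangentBundle I M)) x)
    (hW : MDifferentiableAt I I.tangent (fun x ↦ (⟨x, W x⟩ : TangentBundle I M)) x)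
    (hVv : ∀ x, V x ∈ verticalSpace I J f x) (hWv : ∀ x, W x ∈ verticalSpace I J f x) :
    VectorField.mlieBracket I V W x ∈ verticalSpace I J f x := by
  have key : ∀ U : Π x : M, TangentSpace I x, (∀ x, U x ∈ verticalSpace I J f x) →
      ∀ᶠ y in 𝓝[range I] (extChartAt I x x),
        fderivWithin ℝ (writtenInExtChartAt I J x f) (range I) y
          (VectorField.mpullbackWithin 𝓘(ℝ, E) I (extChartAt I x).symm U (range I) y) = 0 := by
    intro U hU
    have hcont : ContinuousAt (f ∘ (extChartAt I x).symm) (extChartAt I x x) :=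
      ContinuousAt.comp (by simpa using hf.continuous.continuousAt) (continuousAt_extChartAt_symm x)
    have hsrc : (f ∘ (extChartAt I x).symm) ⁻¹' (extChartAt J (f x)).source ∈
        𝓝 (extChartAt I x x) :=
      hcont.preimage_mem_nhds (by simpa using extChartAt_source_mem_nhds (I := J) (f x))
    filter_upwards [extChartAt_target_mem_nhdsWithin x, nhdsWithin_le_nhds hsrc] with y hy hy'
    have U1 : UniqueMDiffWithinAt 𝓘(ℝ, E) (range I) y :=
      I.uniqueMDiffOn y (extChartAt_target_subset_range x hy)
    have hs : MDifferentiableWithinAt 𝓘(ℝ, E) I (extChartAt I x).symm (range I) y :=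
      mdifferentiableWithinAt_extChartAt_symm hy
    have hff : MDifferentiableAt I J f ((extChartAt I x).symm y) :=
      hf.mdifferentiableAt (by simp)
    have hc : MDifferentiableAt J 𝓘(ℝ, E') (extChartAt J (f x)) (f ((extChartAt I x).symm y)) :=
      mdifferentiableAt_extChartAt (by simpa using hy')
    set u := VectorField.mpullbackWithin 𝓘(ℝ, E) I (extChartAt I x).symm U (range I) y with hu
    have hinv := isInvertible_mfderivWithin_extChartAt_symm (I := I) hy
    have hu' : mfderivWithin 𝓘(ℝ, E) I (extChartAt I x).symm (range I) y u =
        U ((extChartAt I x).symm y) := by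
      rw [hu, VectorField.mpullbackWithin_apply]
      exact hinv.self_apply_inverse _
    have e : fderivWithin ℝ (writtenInExtChartAt I J x f) (range I) y u =
        mfderivWithin 𝓘(ℝ, E) 𝓘(ℝ, E') (extChartAt J (f x) ∘ (f ∘ (extChartAt I x).symm))
          (range I) y u := by
      rw [mfderivWithin_eq_fderivWithin]; rfl
    rw [e]
    have h1 := mfderiv_comp_mfderivWithin (I := 𝓘(ℝ, E)) (I' := I) (I'' := J) y hff hs U1
    have h2 := mfderiv_comp_mfderivWithin (I := 𝓘(ℝ, E)) (I' := J) (I'' := 𝓘(ℝ, E'))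
      (f := f ∘ (extChartAt I x).symm) (g := extChartAt J (f x)) y hc
      (hff.comp_mdifferentiableWithinAt y hs) U1
    refine (DFunLike.congr_fun h2 u).trans ?_
    refine (congrArg (mfderiv J 𝓘(ℝ, E') (extChartAt J (f x)) (f ((extChartAt I x).symm y)))
      ((DFunLike.congr_fun h1 u).trans (Eq.trans ?_ (hU ((extChartAt I x).symm y))))).trans
      (map_zero _)
    exact congrArg (mfderiv I J f ((extChartAt I x).symm y)) hu'
  have hy0 : extChartAt I x x ∈ range I := mem_range_self _
  have hd : ∀ U : Π x : M, TangentSpace I x,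
      MDifferentiableAt I I.tangent (fun x ↦ (⟨x, U x⟩ : TangentBundle I M)) x →
      DifferentiableWithinAt ℝ
        (VectorField.mpullbackWithin 𝓘(ℝ, E) I (extChartAt I x).symm U (range I)) (range I)
        (extChartAt I x x) := by
    intro U hU
    have := hU.mdifferentiableWithinAt (s := univ)
    simpa using this.differentiableWithinAt_mpullbackWithin_vectorField
  have hzero : ∀ (U : Π x : M, TangentSpace I x), (∀ x, U x ∈ verticalSpace I J f x) → ∀ w,
      fderivWithin ℝ (fun y ↦ fderivWithin ℝ (writtenInExtChartAt I J x f) (range I) y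
        (VectorField.mpullbackWithin 𝓘(ℝ, E) I (extChartAt I x).symm U (range I) y)) (range I)
        (extChartAt I x x) w = 0 := by
    intro U hU w
    have h := key U hU
    have := Filter.EventuallyEq.fderivWithin_eq (𝕜 := ℝ) (f := fun _ ↦ (0 : E'))
      h (h.self_of_nhdsWithin hy0)
    rw [this]
    simp
  have hfc : ContDiffWithinAt ℝ ∞ (writtenInExtChartAt I J x f) (range I) (extChartAt I x x) := by
    have := (contMDiffAt_iff.1 (hf x)).2
    exact this
  have hcl : extChartAt I x x ∈ closure (interior (range I)) :=
    I.range_subset_closure_interior hy0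
  have h := VectorField.fderivWithin_apply_lieBracket hfc
    (by simpa [minSmoothness_of_isRCLikeNormedField] using ENat.LEInfty.out)
    I.uniqueDiffOn hcl hy0 (hd W hW) (hd V hV)
  replace h := h.trans ((congrArg₂ (· - ·) (hzero W hWv _) (hzero V hVv _)).trans (sub_zero _))
  have hb : VectorField.mlieBracket I V W x = VectorField.lieBracketWithin ℝ
      (VectorField.mpullbackWithin 𝓘(ℝ, E) I (extChartAt I x).symm V (range I))
      (VectorField.mpullbackWithin 𝓘(ℝ, E) I (extChartAt I x).symm W (range I)) (range I)
      (extChartAt I x x) := by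
    rw [← VectorField.mlieBracketWithin_univ, VectorField.mlieBracketWithin_apply,
      mfderiv_extChartAt_self, preimage_univ, univ_inter]
    exact DFunLike.congr_fun (ContinuousLinearMap.inverse_id (R := ℝ) (M := E)) _
  change mfderiv I J f x _ = 0
  rw [hb]
  exact (DFunLike.congr_fun (MDifferentiableAt.mfderiv (hf.mdifferentiableAt (by simp))) _).trans h

end SubmersionFiber

section Forms

variable {E : Type*} [NormedAddCommGroup E] [NormedSpace ℝ E] {H : Type*} [TopologicalSpace H]
  (I : ModelWithCorners ℝ E H) {M : Type*} [TopologicalSpace M] [ChartedSpace H M] [IsManifold I ∞ M] {k : ℕ}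

/-- A family `α` of alternating `k`-forms on the tangent spaces of `M` is smooth (that is, a
differential `k`-form) if it takes smooth local vector fields to smooth functions. -/
def IsSmoothForm (α : Π x : M, TangentSpace I x [⋀^Fin k]→L[ℝ] ℝ) : Prop :=
  ∀ U : Set M, IsOpen U → ∀ X : Fin k → Π x : M, TangentSpace I x,
    (∀ i, ContMDiffOn I I.tangent ∞ (fun x ↦ (⟨x, X i x⟩ : TangentBundle I M)) U) →
    ContMDiffOn I 𝓘(ℝ, ℝ) ∞ (fun x ↦ α x (fun i ↦ X i x)) U

/-- The expression of a `k`-form in the chart around `x₀`. -/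
def formInChart (α : Π x : M, TangentSpace I x [⋀^Fin k]→L[ℝ] ℝ) (x₀ : M) (y : E) :
    E [⋀^Fin k]→L[ℝ] ℝ :=
  (α ((extChartAt I x₀).symm y)).compContinuousLinearMap
    (mfderivWithin 𝓘(ℝ, E) I (extChartAt I x₀).symm (range I) y)

/-- The exterior derivative of a differential form on a manifold: the pullback to the manifold of
the exterior derivative in the model space, through the chart around the point. -/
def mextDeriv (α : Π x : M, TangentSpace I x [⋀^Fin k]→L[ℝ] ℝ) (x₀ : M) :
    TangentSpace I x₀ [⋀^Fin (k + 1)]→L[ℝ] ℝ :=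
  (extDerivWithin (formInChart I α x₀) (range I) (extChartAt I x₀ x₀)).compContinuousLinearMap
    (mfderiv I 𝓘(ℝ, E) (extChartAt I x₀) x₀)

/-- `(M, α)` is a symplectic manifold: `α` is a smooth, closed and nondegenerate 2-form. -/
structure IsSymplecticForm (α : Π x : M, TangentSpace I x [⋀^Fin 2]→L[ℝ] ℝ) : Prop where
  smooth : IsSmoothForm I α
  closed : ∀ x, mextDeriv I α x = 0
  nondegenerate : ∀ (x : M) (v : TangentSpace I x), (∀ w, α x ![v, w] = 0) → v = 0

end Forms

universe u

/-- A Lie groupoid `G ⇉ M`. The multiplication is a total function, of which only the values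
`mul g h` with `source g = target h` are meaningful; it is smooth on the set of these pairs. -/
structure LieGroupoid {E : Type u} [NormedAddCommGroup E] [NormedSpace ℝ E]
    {H : Type*} [TopologicalSpace H] (I : ModelWithCorners ℝ E H)
    {E' : Type*} [NormedAddCommGroup E'] [NormedSpace ℝ E']
    {H' : Type*} [TopologicalSpace H'] (J : ModelWithCorners ℝ E' H')
    (G : Type*) [TopologicalSpace G] [ChartedSpace H G]
    (M : Type*) [TopologicalSpace M] [ChartedSpace H' M] where
  source : G → M
  target : G → M
  unit : M → G
  mul : G → G → G
  inv : G → G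
  source_mul : ∀ g h, source g = target h → source (mul g h) = source h
  target_mul : ∀ g h, source g = target h → target (mul g h) = target g
  mul_assoc : ∀ g h k, source g = target h → source h = target k →
    mul (mul g h) k = mul g (mul h k)
  source_unit : ∀ p, source (unit p) = p
  target_unit : ∀ p, target (unit p) = p
  unit_mul : ∀ g, mul (unit (target g)) g = g
  mul_unit : ∀ g, mul g (unit (source g)) = g
  source_inv : ∀ g, source (inv g) = target g
  target_inv : ∀ g, target (inv g) = source g
  inv_mul : ∀ g, mul (inv g) g = unit (source g)
  mul_inv : ∀ g, mul g (inv g) = unit (target g)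
  contMDiff_source : ContMDiff I J ∞ source
  contMDiff_target : ContMDiff I J ∞ target
  contMDiff_unit : ContMDiff J I ∞ unit
  contMDiff_inv : ContMDiff I I ∞ inv
  contMDiffOn_mul : ContMDiffOn (I.prod I) I ∞ (fun q : G × G ↦ mul q.1 q.2)
    {q : G × G | source q.1 = target q.2}
  source_surjective : Surjective source
  isSubmersion_source : IsSubmersion I J ∞ source

namespace LieGroupoid

variable {E : Type u} [NormedAddCommGroup E] [NormedSpace ℝ E]
  {H : Type*} [TopologicalSpace H] {I : ModelWithCorners ℝ E H}
  {E' : Type*} [NormedAddCommGroup E'] [NormedSpace ℝ E']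
  {H' : Type*} [TopologicalSpace H'] {J : ModelWithCorners ℝ E' H'}
  {G : Type*} [TopologicalSpace G] [ChartedSpace H G]
  {M : Type*} [TopologicalSpace M] [ChartedSpace H' M]
  (𝒢 : LieGroupoid I J G M)

lemma inv_inv (g : G) : 𝒢.inv (𝒢.inv g) = g := by
  have h1 := 𝒢.mul_assoc (𝒢.inv (𝒢.inv g)) (𝒢.inv g) g (𝒢.source_inv _) (𝒢.source_inv g)
  rw [𝒢.inv_mul, 𝒢.inv_mul, 𝒢.source_inv, 𝒢.unit_mul] at h1
  have h2 := 𝒢.mul_unit (𝒢.inv (𝒢.inv g))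
  rw [𝒢.source_inv, 𝒢.target_inv, ← h1] at h2
  exact h2.symm

/-- The inversion of a Lie groupoid, as a homeomorphism. -/
def invHomeomorph : G ≃ₜ G where
  toFun := 𝒢.inv
  invFun := 𝒢.inv
  left_inv := 𝒢.inv_inv
  right_inv := 𝒢.inv_inv
  continuous_toFun := 𝒢.contMDiff_inv.continuous
  continuous_invFun := 𝒢.contMDiff_inv.continuous

lemma isSubmersion_target [IsManifold I ∞ G] : IsSubmersion I J ∞ 𝒢.target := by
  refine ⟨𝒢.isSubmersion_source.complement, inferInstance, inferInstance, fun g ↦ ?_⟩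
  have h := SubmersionFiber.normalForm 𝒢.isSubmersion_source (𝒢.inv g)
  have hti : ∀ g, 𝒢.source (𝒢.inv g) = 𝒢.target g := 𝒢.source_inv
  have hi : ∀ g, 𝒢.invHomeomorph g = 𝒢.inv g := fun _ ↦ rfl
  refine IsSubmersionAtOfComplement.mk_of_charts h.equiv
    (𝒢.invHomeomorph.toOpenPartialHomeomorph.trans h.domChart) h.codChart ?_ ?_ ?_
    h.codChart_mem_maximalAtlas ?_ ?_
  · simpa [hi] using h.mem_domChart_source
  · rw [← hti]; exact h.mem_codChart_source
  · refine OpenPartialHomeomorph.mem_maximalAtlas_of_contMDiffOn _ ?_ ?_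
    · exact (contMDiffOn_of_mem_maximalAtlas h.domChart_mem_maximalAtlas).comp
        𝒢.contMDiff_inv.contMDiffOn (fun z hz ↦ by simpa using hz)
    · exact (𝒢.contMDiff_inv.comp_contMDiffOn
        (contMDiffOn_symm_of_mem_maximalAtlas h.domChart_mem_maximalAtlas)).mono
        (fun z hz ↦ by simpa using hz)
  · intro z hz
    rw [mem_preimage, ← hti]
    exact h.source_subset_preimage_source (by simpa [hi] using hz)
  · intro z hz
    have hz' : z ∈ (h.domChart.extend I).target := by
      simpa [OpenPartialHomeomorph.extend_target] using hz
    rw [← h.writtenInCharts hz']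
    simp only [comp_apply]
    rw [← hti]
    exact congrArg (fun w ↦ h.codChart.extend J (𝒢.source w)) (𝒢.inv_inv _)

variable [IsManifold I ∞ G]

/-- The fibre `t⁻¹(p)` of the target map, as an embedded submanifold of `G`. -/
abbrev tFiber (p : M) := SubmersionFiber 𝒢.isSubmersion_target p

/-- The model vector space of the fibres of the target map. -/
abbrev tModel := 𝒢.isSubmersion_target.complement

/-- The fibre at `g` of `TᵗG = ker t_*`. -/
abbrev tTangent (g : G) : Submodule ℝ (TangentSpace I g) := verticalSpace I J 𝒢.target g

/-- The fibre at `p` of the Lie algebroid `AG = TᵗG|_M`. -/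
abbrev algebroidFiber (p : M) : Submodule ℝ (TangentSpace I (𝒢.unit p)) := 𝒢.tTangent (𝒢.unit p)

/-- The unit `1_p`, as a point of `t⁻¹(p)`. -/
def unitPoint (p : M) : 𝒢.tFiber p := ⟨𝒢.unit p, 𝒢.target_unit p⟩

/-- Left multiplication `l_g : t⁻¹(s(g)) → t⁻¹(t(g))`. -/
def leftMul (g : G) (h : 𝒢.tFiber (𝒢.source g)) : 𝒢.tFiber (𝒢.target g) :=
  ⟨𝒢.mul g h.incl, 𝒢.target_mul _ _ h.map_incl.symm⟩

variable [I.Boundaryless]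

/-- The left-invariant vector field `X̃_g = (l_g)_{*,1_{s(g)}} X_{s(g)}` on `G` associated to a
section `X` of `AG`; here `l_g` is regarded as a map into `G`, and `(AG)_p` is identified with the
tangent space of `t⁻¹(p)` at `1_p`. -/
def leftInvariantField (X : Π p, 𝒢.algebroidFiber p) (g : G) : TangentSpace I g :=
  mfderiv 𝓘(ℝ, 𝒢.tModel) I (fun h ↦ (𝒢.leftMul g h).incl) (𝒢.unitPoint (𝒢.source g))
    ((SubmersionFiber.tangentEquiv (𝒢.unitPoint (𝒢.source g))).symm (X (𝒢.source g)))

lemma contMDiff_incl_leftMul (g : G) :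
    ContMDiff 𝓘(ℝ, 𝒢.tModel) I ∞ (fun h ↦ (𝒢.leftMul g h).incl) := by
  have h1 : ContMDiff 𝓘(ℝ, 𝒢.tModel) (I.prod I) ∞
      (fun h : 𝒢.tFiber (𝒢.source g) ↦ (g, h.incl)) :=
    contMDiff_const.prodMk SubmersionFiber.contMDiff_incl
  exact 𝒢.contMDiffOn_mul.comp_contMDiff h1 (fun h ↦ h.map_incl.symm)

lemma leftInvariantField_mem (X : Π p, 𝒢.algebroidFiber p) (g : G) :
    𝒢.leftInvariantField X g ∈ 𝒢.tTangent g := by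
  set x₀ := 𝒢.unitPoint (𝒢.source g) with hx₀
  have hg : (𝒢.leftMul g x₀).incl = g := 𝒢.mul_unit g
  have h1 : MDifferentiableAt I J 𝒢.target g := 𝒢.contMDiff_target.mdifferentiableAt (by simp)
  have h2 : MDifferentiableAt 𝓘(ℝ, 𝒢.tModel) I (fun h ↦ (𝒢.leftMul g h).incl) x₀ :=
    (𝒢.contMDiff_incl_leftMul g).mdifferentiableAt (by simp)
  have h3 : 𝒢.target ∘ (fun h ↦ (𝒢.leftMul g h).incl) = fun _ ↦ 𝒢.target g :=
    funext fun h ↦ (𝒢.leftMul g h).map_incl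
  have h4 := mfderiv_comp_apply_of_eq x₀ h1 h2 hg
    ((SubmersionFiber.tangentEquiv x₀).symm (X (𝒢.source g)))
  rw [h3, mfderiv_const] at h4
  exact h4.symm

lemma contMDiffAt_leftInvariantField {X : Π p, 𝒢.algebroidFiber p} {g₀ : G}
    (hX : ContMDiffAt J I.tangent ∞ (fun p ↦ (⟨𝒢.unit p, X p⟩ : TangentBundle I G))
      (𝒢.source g₀)) :
    ContMDiffAt I I.tangent ∞
      (fun g ↦ (⟨g, 𝒢.leftInvariantField X g⟩ : TangentBundle I G)) g₀ := by
  set hf := 𝒢.isSubmersion_target with hhf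
  set e₀ : G := 𝒢.unit (𝒢.source g₀) with he₀
  have he₀s : e₀ ∈ (SubmersionFiber.normalForm hf e₀).domChart.source :=
    (SubmersionFiber.normalForm hf e₀).mem_domChart_source
  have hsrc : (SubmersionFiber.normalForm hf e₀).domChart.source ∈ 𝓝 e₀ :=
    (SubmersionFiber.normalForm hf e₀).domChart.open_source.mem_nhds he₀s
  have hη : ∀ z ∈ (SubmersionFiber.normalForm hf e₀).domChart.source,
      ContMDiffAt I 𝓘(ℝ, hf.complement) ∞ (SubmersionFiber.coord hf e₀) z := fun z hz ↦
    (SubmersionFiber.contMDiffOn_coord e₀).contMDiffAt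
      ((SubmersionFiber.normalForm hf e₀).domChart.open_source.mem_nhds hz)
  set K : G → hf.complement → G :=
    fun g v ↦ 𝒢.mul g (SubmersionFiber.point hf e₀ (𝒢.source g) v) with hK
  set O : Set (G × hf.complement) :=
    (fun q ↦ (𝒢.source q.1, q.2)) ⁻¹' SubmersionFiber.pointDomain hf e₀ with hO
  have hOo : IsOpen O := (SubmersionFiber.isOpen_pointDomain e₀).preimage
    ((𝒢.contMDiff_source.continuous.comp continuous_fst).prodMk continuous_snd)
  have hKO : ContMDiffOn (I.prod 𝓘(ℝ, hf.complement)) I ∞ (uncurry K) O := by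
    have h1 : ContMDiffOn (I.prod 𝓘(ℝ, hf.complement)) I ∞
        (fun q : G × hf.complement ↦ SubmersionFiber.point hf e₀ (𝒢.source q.1) q.2) O := by
      have h0 : ContMDiffOn (I.prod 𝓘(ℝ, hf.complement)) (J.prod 𝓘(ℝ, hf.complement)) ∞
          (fun q : G × hf.complement ↦ (𝒢.source q.1, q.2)) O :=
        ((𝒢.contMDiff_source.comp contMDiff_fst).prodMk contMDiff_snd).contMDiffOn
      have h2 := SubmersionFiber.contMDiffOn_point (hf := hf) e₀
      exact h2.comp h0 (mapsTo_preimage _ _)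
    have h3 : ContMDiffOn (I.prod 𝓘(ℝ, hf.complement)) (I.prod I) ∞ (fun q : G × hf.complement ↦
        (q.1, SubmersionFiber.point hf e₀ (𝒢.source q.1) q.2)) O := contMDiffOn_fst.prodMk h1
    refine 𝒢.contMDiffOn_mul.comp h3 ?_
    intro q hq
    exact (SubmersionFiber.map_point (p := (𝒢.source q.1, q.2)) hq).symm
  have hus : ContMDiff I I ∞ (fun g ↦ 𝒢.unit (𝒢.source g)) :=
    𝒢.contMDiff_unit.comp 𝒢.contMDiff_source
  have hmem : ∀ g, 𝒢.unit (𝒢.source g) ∈ (SubmersionFiber.normalForm hf e₀).domChart.source →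
      (g, SubmersionFiber.coord hf e₀ (𝒢.unit (𝒢.source g))) ∈ O := by
    intro g hg
    have := SubmersionFiber.mem_pointDomain hg
    rwa [𝒢.target_unit] at this
  have hv : ContMDiffAt I 𝓘(ℝ, hf.complement) ∞
      (fun g ↦ SubmersionFiber.coord hf e₀ (𝒢.unit (𝒢.source g))) g₀ :=
    ContMDiffAt.comp (g := SubmersionFiber.coord hf e₀) (f := fun g ↦ 𝒢.unit (𝒢.source g)) g₀
      (hη e₀ he₀s) hus.contMDiffAt
  have hX' : ContMDiffAt I I.tangent ∞
      (fun g ↦ (⟨𝒢.unit (𝒢.source g), X (𝒢.source g)⟩ : TangentBundle I G)) g₀ :=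
    hX.comp g₀ 𝒢.contMDiff_source.contMDiffAt
  have hw1 := ContMDiffAt.mfderiv (I := I) (I' := 𝓘(ℝ, hf.complement)) (J := I) (m := ∞) (n := ∞)
    (fun _ : G ↦ SubmersionFiber.coord hf e₀)
    (fun g ↦ 𝒢.unit (𝒢.source g)) (x₀ := g₀)
    (ContMDiffAt.comp (g := SubmersionFiber.coord hf e₀) (f := Prod.snd) (g₀, e₀) (hη e₀ he₀s)
      contMDiffAt_snd) hus.contMDiffAt (by simp)
  have hw := ContMDiffAt.clm_apply_of_inCoordinates hw1 hX' hv
  have hk1 := ContMDiffAt.mfderiv (I := 𝓘(ℝ, hf.complement)) (I' := I) (J := I) (m := ∞) (n := ∞)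
    K (fun g ↦ SubmersionFiber.coord hf e₀ (𝒢.unit (𝒢.source g))) (x₀ := g₀)
    (hKO.contMDiffAt (hOo.mem_nhds (hmem g₀ he₀s))) hv (by simp)
  have hKv : ∀ g, 𝒢.unit (𝒢.source g) ∈ (SubmersionFiber.normalForm hf e₀).domChart.source →
      K g (SubmersionFiber.coord hf e₀ (𝒢.unit (𝒢.source g))) = g := by
    intro g hg
    have := SubmersionFiber.point_coord hg
    rw [𝒢.target_unit] at this
    rw [hK]
    simp only [this, 𝒢.mul_unit]
  have hnear : ∀ᶠ g in 𝓝 g₀,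
      𝒢.unit (𝒢.source g) ∈ (SubmersionFiber.normalForm hf e₀).domChart.source :=
    hus.continuous.continuousAt.preimage_mem_nhds hsrc
  have hKc : ContMDiffAt I I ∞
      (fun g ↦ K g (SubmersionFiber.coord hf e₀ (𝒢.unit (𝒢.source g)))) g₀ := by
    refine contMDiffAt_id.congr_of_eventuallyEq ?_
    filter_upwards [hnear] with g hg using hKv g hg
  have hk := ContMDiffAt.clm_apply_of_inCoordinates hk1 hw hKc
  refine hk.congr_of_eventuallyEq ?_
  filter_upwards [hnear] with g hg
  have total_ext : ∀ (a b : G) (v w : E), a = b → v = w →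
      ((⟨a, v⟩ : TangentBundle I G) = ⟨b, w⟩) := by
    rintro a _ v _ rfl rfl
    rfl
  refine total_ext _ _ _ _ (hKv g hg).symm ?_
  set x₀ := 𝒢.unitPoint (𝒢.source g) with hx₀
  set ξ := (SubmersionFiber.tangentEquiv x₀).symm (X (𝒢.source g)) with hξ
  have hιξ : mfderiv 𝓘(ℝ, hf.complement) I SubmersionFiber.incl x₀ ξ =
      (X (𝒢.source g)).1 := by
    have := (SubmersionFiber.tangentEquiv x₀).apply_symm_apply (X (𝒢.source g))
    exact congrArg Subtype.val this
  have hηg : MDifferentiableAt I 𝓘(ℝ, hf.complement) (SubmersionFiber.coord hf e₀)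
      (𝒢.unit (𝒢.source g)) := (hη _ hg).mdifferentiableAt (by simp)
  have hKg : MDifferentiableAt 𝓘(ℝ, hf.complement) I (K g)
      (SubmersionFiber.coord hf e₀ (𝒢.unit (𝒢.source g))) := by
    have h1 := hKO.contMDiffAt (hOo.mem_nhds (hmem g hg))
    have h2 : ContMDiffAt 𝓘(ℝ, hf.complement) (I.prod 𝓘(ℝ, hf.complement)) ∞ (fun v ↦ (g, v))
      (SubmersionFiber.coord hf e₀ (𝒢.unit (𝒢.source g))) :=
      contMDiffAt_const.prodMk contMDiffAt_id
    exact (h1.comp _ h2).mdifferentiableAt (by simp)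
  have hcomp : (fun h ↦ (𝒢.leftMul g h).incl) =ᶠ[𝓝 x₀]
      K g ∘ (SubmersionFiber.coord hf e₀ ∘ SubmersionFiber.incl) := by
    have : (SubmersionFiber.incl : 𝒢.tFiber (𝒢.source g) → G) ⁻¹'
        (SubmersionFiber.normalForm hf e₀).domChart.source ∈ 𝓝 x₀ :=
      SubmersionFiber.isInducing_incl.continuous.continuousAt.preimage_mem_nhds
        ((SubmersionFiber.normalForm hf e₀).domChart.open_source.mem_nhds hg)
    filter_upwards [this] with z hz
    have := SubmersionFiber.point_coord_incl hz
    simp only [hK, comp_apply, this]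
    rfl
  have hin := SubmersionFiber.mdifferentiableAt_incl x₀
  have d1 := mfderiv_comp_apply x₀ hηg hin ξ
  have d2 := mfderiv_comp_apply x₀ hKg (hηg.comp x₀ hin) ξ
  refine (DFunLike.congr_fun
    (hcomp.mfderiv_eq (I := 𝓘(ℝ, hf.complement)) (I' := I)) ξ).trans (d2.trans ?_)
  refine congrArg (mfderiv 𝓘(ℝ, hf.complement) I (K g)
    (SubmersionFiber.coord hf e₀ (𝒢.unit (𝒢.source g)))) (d1.trans ?_)
  exact congrArg (mfderiv I 𝓘(ℝ, hf.complement) (SubmersionFiber.coord hf e₀)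
    (𝒢.unit (𝒢.source g))) hιξ

/-- A smooth section of the Lie algebroid `AG`. -/
structure AlgebroidSection where
  toFun : Π p, 𝒢.algebroidFiber p
  contMDiff_toFun : ContMDiff J I.tangent ∞ (fun p ↦ (⟨𝒢.unit p, toFun p⟩ : TangentBundle I G))

instance : CoeFun 𝒢.AlgebroidSection (fun _ ↦ Π p, 𝒢.algebroidFiber p) :=
  ⟨AlgebroidSection.toFun⟩

lemma contMDiff_leftInvariantField (X : 𝒢.AlgebroidSection) :
    ContMDiff I I.tangent ∞ (fun g ↦ (⟨g, 𝒢.leftInvariantField X g⟩ : TangentBundle I G)) :=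
  fun _ ↦ 𝒢.contMDiffAt_leftInvariantField X.contMDiff_toFun.contMDiffAt

/-- The bracket `[X, Y] = [X̃, Ỹ]|_M` of two sections of `AG`. -/
def bracket [FiniteDimensional ℝ E] [IsManifold J ∞ M] (X Y : 𝒢.AlgebroidSection) :
    𝒢.AlgebroidSection where
  toFun p := ⟨VectorField.mlieBracket I (𝒢.leftInvariantField X) (𝒢.leftInvariantField Y)
      (𝒢.unit p), have := FiniteDimensional.complete ℝ E
      mlieBracket_mem_verticalSpace 𝒢.contMDiff_target
        ((𝒢.contMDiff_leftInvariantField X).mdifferentiableAt (by simp))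
        ((𝒢.contMDiff_leftInvariantField Y).mdifferentiableAt (by simp))
        (𝒢.leftInvariantField_mem X) (𝒢.leftInvariantField_mem Y)⟩
  contMDiff_toFun := by
    have := FiniteDimensional.complete ℝ E
    have i1 : IsManifold I (minSmoothness ℝ 2) G := IsManifold.of_le (n := ∞)
      (by simpa [minSmoothness_of_isRCLikeNormedField] using ENat.LEInfty.out)
    have i2 : IsManifold I (((⊤ : ℕ∞) : WithTop ℕ∞) + 1) G := by simpa
    have i3 : IsManifold I (minSmoothness ℝ 3) G := IsManifold.of_le (n := ∞)
      (by simpa [minSmoothness_of_isRCLikeNormedField] using ENat.LEInfty.out)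
    have h : ContMDiff I I.tangent ∞ (fun g ↦ (⟨g, VectorField.mlieBracket I
        (𝒢.leftInvariantField X) (𝒢.leftInvariantField Y) g⟩ : TangentBundle I G)) := fun g ↦
      ContMDiffAt.mlieBracket_vectorField (n := ⊤) (m := ⊤)
        (𝒢.contMDiff_leftInvariantField X).contMDiffAt
        (𝒢.contMDiff_leftInvariantField Y).contMDiffAt
        (by simp [minSmoothness_of_isRCLikeNormedField])
    exact h.comp 𝒢.contMDiff_unit

/-- The anchor `ρ = s_*|_{AG} : AG → TM`. -/
def anchor (p : M) : 𝒢.algebroidFiber p →L[ℝ] TangentSpace J p :=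
  (show TangentSpace I (𝒢.unit p) →L[ℝ] TangentSpace J p from
    mfderiv I J 𝒢.source (𝒢.unit p)).comp (𝒢.algebroidFiber p).subtypeL

/-- The derivative `ρ(X)[f]` of a function `f` on `M` along a section `X` of `AG`. -/
def anchorDeriv (X : 𝒢.AlgebroidSection) (f : M → ℝ) (p : M) : ℝ :=
  mfderiv J 𝓘(ℝ, ℝ) f p (𝒢.anchor p (X p))

/-- The value `(d_{AG} α)(X, Y, Z)` of the Lie algebroid differential of a 2-form `α` on `AG`. -/
def algebroidDeriv [FiniteDimensional ℝ E] [IsManifold J ∞ M]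
    (α : Π p, 𝒢.algebroidFiber p [⋀^Fin 2]→L[ℝ] ℝ) (X Y Z : 𝒢.AlgebroidSection) (p : M) : ℝ :=
  𝒢.anchorDeriv X (fun q ↦ α q ![Y q, Z q]) p - 𝒢.anchorDeriv Y (fun q ↦ α q ![X q, Z q]) p
    + 𝒢.anchorDeriv Z (fun q ↦ α q ![X q, Y q]) p - α p ![𝒢.bracket X Y p, Z p]
    + α p ![𝒢.bracket X Z p, Y p] - α p ![𝒢.bracket Y Z p, X p]

/-- The space `Γ(∧ᵏ(AG)*)` of smooth sections of `∧ᵏ(AG)*`: a family of `k`-forms on the fibres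
of `AG` is smooth if it takes smooth local sections of `AG` to smooth functions. -/
def algebroidForms (k : ℕ) : Submodule ℝ (Π p, 𝒢.algebroidFiber p [⋀^Fin k]→L[ℝ] ℝ) where
  carrier := {α | ∀ U : Set M, IsOpen U → ∀ X : Fin k → Π p, 𝒢.algebroidFiber p,
    (∀ i, ContMDiffOn J I.tangent ∞ (fun p ↦ (⟨𝒢.unit p, X i p⟩ : TangentBundle I G)) U) →
    ContMDiffOn J 𝓘(ℝ, ℝ) ∞ (fun p ↦ α p (fun i ↦ X i p)) U}
  add_mem' ha hb U hU X hX := (ha U hU X hX).add (hb U hU X hX)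
  zero_mem' _ _ _ _ := contMDiffOn_const
  smul_mem' c _ ha U hU X hX :=
    (contMDiffOn_const : ContMDiffOn J 𝓘(ℝ, ℝ) ∞ (fun _ ↦ c) U).smul (ha U hU X hX)

/-- The restriction of a section of `∧ᵏ(TᵗG)*` to the fibre `t⁻¹(p)`. -/
def restrictFiber {k : ℕ} (α : Π g, 𝒢.tTangent g [⋀^Fin k]→L[ℝ] ℝ) (p : M) (x : 𝒢.tFiber p) :
    TangentSpace 𝓘(ℝ, 𝒢.tModel) x [⋀^Fin k]→L[ℝ] ℝ :=
  (α x.incl).compContinuousLinearMap (SubmersionFiber.inclDeriv x)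

/-- A section `α` of `∧ᵏ(TᵗG)*` is left-invariant if
`(l_g)^*(α|_{t⁻¹(t(g))}) = α|_{t⁻¹(s(g))}` for all `g`. -/
def IsLeftInvariant {k : ℕ} (α : Π g, 𝒢.tTangent g [⋀^Fin k]→L[ℝ] ℝ) : Prop :=
  ∀ (g : G) (h : 𝒢.tFiber (𝒢.source g)),
    (𝒢.restrictFiber α (𝒢.target g) (𝒢.leftMul g h)).compContinuousLinearMap
      (mfderiv 𝓘(ℝ, 𝒢.tModel) 𝓘(ℝ, 𝒢.tModel) (𝒢.leftMul g) h) =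
    𝒢.restrictFiber α (𝒢.source g) h

/-- The space `Γ_L(∧ᵏ(TᵗG)*)` of left-invariant smooth sections of `∧ᵏ(TᵗG)*`; smoothness means
that smooth local sections of `TᵗG` are taken to smooth functions. -/
def leftInvariantForms (k : ℕ) : Submodule ℝ (Π g, 𝒢.tTangent g [⋀^Fin k]→L[ℝ] ℝ) where
  carrier := {α | (∀ U : Set G, IsOpen U → ∀ X : Fin k → Π g, 𝒢.tTangent g,
    (∀ i, ContMDiffOn I I.tangent ∞ (fun g ↦ (⟨g, X i g⟩ : TangentBundle I G)) U) →
    ContMDiffOn I 𝓘(ℝ, ℝ) ∞ (fun g ↦ α g (fun i ↦ X i g)) U) ∧ 𝒢.IsLeftInvariant α}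
  add_mem' ha hb := ⟨fun U hU X hX ↦ (ha.1 U hU X hX).add (hb.1 U hU X hX), fun g h ↦ by
    ext v
    exact congrArg₂ (· + ·) (DFunLike.congr_fun (ha.2 g h) v) (DFunLike.congr_fun (hb.2 g h) v)⟩
  zero_mem' := ⟨fun _ _ _ _ ↦ contMDiffOn_const, fun _ _ ↦ rfl⟩
  smul_mem' c _ ha := ⟨fun U hU X hX ↦
    (contMDiffOn_const : ContMDiffOn I 𝓘(ℝ, ℝ) ∞ (fun _ ↦ c) U).smul (ha.1 U hU X hX), fun g h ↦ by
    ext v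
    exact congrArg (c * ·) (DFunLike.congr_fun (ha.2 g h) v)⟩

/-- A `t`-symplectic form: a left-invariant section of `∧²(TᵗG)*` whose restriction to every
fibre of `t` is symplectic. -/
def IsTSymplectic (α : 𝒢.leftInvariantForms 2) : Prop :=
  ∀ p, IsSymplecticForm 𝓘(ℝ, 𝒢.tModel) (𝒢.restrictFiber α.1 p)

/-- A quasi-Frobenius structure on `AG`: a nondegenerate 2-form `α` with `d_{AG} α = 0`. -/
structure IsQuasiFrobenius [FiniteDimensional ℝ E] [IsManifold J ∞ M] (α : 𝒢.algebroidForms 2) :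
    Prop where
  nondegenerate : ∀ (p : M) (v : 𝒢.algebroidFiber p), (∀ w, α.1 p ![v, w] = 0) → v = 0
  closed : ∀ (X Y Z : 𝒢.AlgebroidSection) (p : M), 𝒢.algebroidDeriv α.1 X Y Z p = 0

end LieGroupoid

end

/-! For an arrow `g`, left translation `l_g : t⁻¹(s(g)) → t⁻¹(t(g))` is a diffeomorphism with
inverse `l_{g⁻¹}`, and it takes the unit at `s(g)` to `g`. Hence every tangent vector of a `t`-fibre
at `g` is the left translate of exactly one element of `AG` at `s(g)`. A left-invariant form is
therefore determined by its values at the units (`IsLeftInvariant.ext`). Conversely, a form `ω` on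
`AG` extends by `ω̃_g = (l_{g⁻¹})^* ω_{s(g)}`, which is left-invariant because `l_g l_h = l_{gh}`
and `s(gh) = s(h)`.

The analytic content of this bijection is smoothness of `ω̃`. Smoothness of a form is tested on
local sections; `contMDiffAt_verticalForm_apply` extends the test to smooth families of vertical
vectors along a map, by expanding them in a local vertical frame. `contMDiffAt_translateToUnit`
shows that translating a smooth vertical field to the units gives such a family.

Nondegeneracy transfers because translations are linear isomorphisms on tangent spaces. For
closedness, let `X̃` be the left-invariant field of a section `X`, restricted to a `t`-fibre. Three
facts hold: `ω̃(X̃, Ỹ) = ω(X, Y) ∘ s`; `s_* X̃ = ρ(X) ∘ s`, since `s ∘ l_g = s`; and `[X̃, Ỹ]` is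
the left-invariant field of `[X, Y]`, since brackets respect related fields
(`mlieBracket_fiberField`). Substituted in the invariant formula for the exterior derivative, they
give `(dω̃)(X̃, Ỹ, Z̃) = (d_{AG} ω)(X, Y, Z) ∘ s` (`mextDeriv_restrictFiber`). Bump functions
provide sections of `AG` with any prescribed value at a point, so left-invariant fields attain every
tangent vector of a fibre (`exists_fiberField_eq`), and every point of `M` is the source of its
unit. Thus one differential vanishes if and only if the other does. -/

noncomputable section

/-! ### Smooth families of tangent vectors and of alternating maps. -/

section GeneralManifolds

variable {E : Type*} [NormedAddCommGroup E] [NormedSpace ℝ E] {H : Type*} [TopologicalSpace H]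
  {E' : Type*} [NormedAddCommGroup E'] [NormedSpace ℝ E'] {H' : Type*} [TopologicalSpace H']
  {J : ModelWithCorners ℝ E' H'} {N : Type*} [TopologicalSpace N] [ChartedSpace H' N]
  {F : Type*} [NormedAddCommGroup F] [NormedSpace ℝ F] {H'' : Type*} [TopologicalSpace H'']
  {K : ModelWithCorners ℝ F H''} {P : Type*} [TopologicalSpace P] [ChartedSpace H'' P]
  {I : ModelWithCorners ℝ E H} {M : Type*} [TopologicalSpace M] [ChartedSpace H M]

/-- Applying the derivatives of a smooth family of maps to a smooth family of tangent vectors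
gives a smooth family of tangent vectors. -/
lemma ContMDiffAt.mfderiv_family_apply [IsManifold K ∞ P] [IsManifold I ∞ M] [IsManifold J ∞ N]
    {f : P → M → N} {g : P → M} {v : Π x, TangentSpace I (g x)} {x₀ : P}
    (hf : ContMDiffAt (K.prod I) J ∞ (uncurry f) (x₀, g x₀))
    (hv : ContMDiffAt K I.tangent ∞ (fun x ↦ (⟨g x, v x⟩ : TangentBundle I M)) x₀) :
    ContMDiffAt K J.tangent ∞
      (fun x ↦ (⟨f x (g x), mfderiv I J (f x) (g x) (v x)⟩ : TangentBundle J N)) x₀ := by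
  have hg : ContMDiffAt K I ∞ g x₀ := ((Bundle.contMDiffAt_totalSpace).1 hv).1
  have h1 := ContMDiffAt.mfderiv (I := I) (I' := J) (J := K) (m := ∞) (n := ∞) f g hf hg (by simp)
  have h2 : ContMDiffAt K J ∞ (fun x ↦ f x (g x)) x₀ :=
    ContMDiffAt.comp (g := uncurry f) (f := fun x ↦ (x, g x)) x₀ hf (contMDiffAt_id.prodMk hg)
  exact ContMDiffAt.clm_apply_of_inCoordinates h1 hv h2

/-- Applying the derivative of a smooth map to a smooth family of tangent vectors gives a smooth
family of tangent vectors. -/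
lemma ContMDiffAt.mfderiv_comp_apply [IsManifold K ∞ P] [IsManifold I ∞ M] [IsManifold J ∞ N]
    {f : M → N} {g : P → M} {v : Π x, TangentSpace I (g x)} {x₀ : P}
    (hf : ContMDiffAt I J ∞ f (g x₀))
    (hv : ContMDiffAt K I.tangent ∞ (fun x ↦ (⟨g x, v x⟩ : TangentBundle I M)) x₀) :
    ContMDiffAt K J.tangent ∞
      (fun x ↦ (⟨f (g x), mfderiv I J f (g x) (v x)⟩ : TangentBundle J N)) x₀ :=
  ContMDiffAt.mfderiv_family_apply (f := fun _ ↦ f)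
    (ContMDiffAt.comp (g := f) (f := Prod.snd) (x₀, g x₀) hf contMDiffAt_snd) hv

/-- A map to the tangent bundle of a vector space is smooth if both of its components are. -/
lemma contMDiffAt_tangentBundle_vectorSpace_iff {g : P → E} {v : P → E} {x₀ : P} :
    ContMDiffAt K 𝓘(ℝ, E).tangent ∞ (fun x ↦ (⟨g x, v x⟩ : TangentBundle 𝓘(ℝ, E) E)) x₀ ↔
      ContMDiffAt K 𝓘(ℝ, E) ∞ g x₀ ∧ ContMDiffAt K 𝓘(ℝ, E) ∞ v x₀ := by
  rw [Bundle.contMDiffAt_totalSpace]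
  simp

/-- All tangent spaces are the model space `E` by definition, so vectors over two base points can be
compared in `E` without transport along `a = b`. -/
lemma tangentBundle_mk_congr {a b : M} {v : TangentSpace I a} {w : TangentSpace I b} (hab : a = b)
    (hvw : (v : E) = (w : E)) : (⟨a, v⟩ : TangentBundle I M) = ⟨b, w⟩ := by
  subst hab
  exact congrArg _ hvw

/-- The value of an alternating map on linear combinations of a family of vectors. -/
lemma ContinuousAlternatingMap.map_sum_smul {V : Type*} [AddCommGroup V] [Module ℝ V]
    [TopologicalSpace V] {ι : Type*} [Fintype ι] {k : ℕ} (α : V [⋀^Fin k]→L[ℝ] ℝ)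
    (c : Fin k → ι → ℝ) (e : ι → V) :
    α (fun i ↦ ∑ j, c i j • e j) =
      ∑ r : Fin k → ι, (∏ i, c i (r i)) * α (fun i ↦ e (r i)) := by
  classical
  have h := α.toMultilinearMap.map_sum (g := fun i j ↦ c i j • e j)
  refine h.trans (Finset.sum_congr rfl fun r _ ↦ ?_)
  exact α.toMultilinearMap.map_smul_univ (fun i ↦ c i (r i)) (fun i ↦ e (r i))

/-- A family of alternating maps on a finite-dimensional space is differentiable if its values on
each tuple of vectors are. -/
lemma ContinuousAlternatingMap.differentiableAt_of_apply {V : Type*} [NormedAddCommGroup V]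
    [NormedSpace ℝ V] [FiniteDimensional ℝ V] {k : ℕ} {θ : E → V [⋀^Fin k]→L[ℝ] ℝ} {x : E}
    (h : ∀ v : Fin k → V, DifferentiableAt ℝ (fun y ↦ θ y v) x) : DifferentiableAt ℝ θ x := by
  let b := Module.finBasis ℝ V
  let T : (V [⋀^Fin k]→L[ℝ] ℝ) →ₗ[ℝ] ((Fin k → Fin (Module.finrank ℝ V)) → ℝ) :=
    { toFun := fun α r ↦ α (fun i ↦ b (r i))
      map_add' := fun _ _ ↦ rfl
      map_smul' := fun _ _ ↦ rfl }
  have hT : LinearMap.ker T = ⊥ := by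
    rw [LinearMap.ker_eq_bot]
    intro α β hαβ
    have : α.toMultilinearMap = β.toMultilinearMap :=
      Module.Basis.ext_multilinear (fun _ ↦ b) fun r ↦ congrFun hαβ r
    ext v
    exact DFunLike.congr_fun this v
  obtain ⟨S, hS⟩ := T.exists_leftInverse_of_injective hT
  have h1 : DifferentiableAt ℝ (fun y ↦ T (θ y)) x :=
    differentiableAt_pi.2 fun r ↦ h fun i ↦ b (r i)
  have h2 := (S.toContinuousLinearMap).differentiableAt.comp x h1
  refine h2.congr_of_eventuallyEq (Filter.Eventually.of_forall fun y ↦ ?_)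
  exact (DFunLike.congr_fun hS (θ y)).symm

end GeneralManifolds

/-! ### Fibres of a submersion: maps into them, and local frames of vertical vectors. -/

section SubmersionFiberFrame

universe u

variable {E : Type u} [NormedAddCommGroup E] [NormedSpace ℝ E] {H : Type*} [TopologicalSpace H]
  {I : ModelWithCorners ℝ E H}
  {E' : Type*} [NormedAddCommGroup E'] [NormedSpace ℝ E'] {H' : Type*} [TopologicalSpace H']
  {J : ModelWithCorners ℝ E' H'}
  {M : Type*} [TopologicalSpace M] [ChartedSpace H M]
  {N : Type*} [TopologicalSpace N] [ChartedSpace H' N] {f : M → N}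
  {F : Type*} [NormedAddCommGroup F] [NormedSpace ℝ F] {H'' : Type*} [TopologicalSpace H'']
  {K : ModelWithCorners ℝ F H''} {P : Type*} [TopologicalSpace P] [ChartedSpace H'' P]
  {F' : Type*} [NormedAddCommGroup F'] [NormedSpace ℝ F'] {H''' : Type*} [TopologicalSpace H''']
  {K' : ModelWithCorners ℝ F' H'''} {Q : Type*} [TopologicalSpace Q] [ChartedSpace H''' Q]

namespace SubmersionFiber

variable {hf : IsSubmersion I J ∞ f} {y : N}

lemma source_mem_nhds {x z : M} (hz : z ∈ (normalForm hf x).domChart.source) :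
    (normalForm hf x).domChart.source ∈ 𝓝 z :=
  (normalForm hf x).domChart.open_source.mem_nhds hz

lemma contMDiffAt_coord {x z : M} (hz : z ∈ (normalForm hf x).domChart.source) :
    ContMDiffAt I 𝓘(ℝ, hf.complement) ∞ (coord hf x) z :=
  (contMDiffOn_coord x).contMDiffAt (source_mem_nhds hz)

/-- A normal form identifies `E` with `E' × hf.complement`. A point of `M` is needed for a normal
form to exist. -/
instance finiteDimensional_complement [FiniteDimensional ℝ E] (hf : IsSubmersion I J ∞ f)
    [Nonempty M] : FiniteDimensional ℝ hf.complement := by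
  have e := (normalForm hf (Classical.arbitrary M)).equiv
  have : FiniteDimensional ℝ (E' × hf.complement) := e.toLinearEquiv.finiteDimensional
  exact FiniteDimensional.of_injective (LinearMap.inr ℝ E' hf.complement) LinearMap.inr_injective

/-- A map into a fibre is smooth if it is smooth as a map into the total space. -/
lemma contMDiffAt_of_incl [I.Boundaryless] {φ : P → SubmersionFiber hf y} {x₀ : P}
    (h : ContMDiffAt K I ∞ (fun x ↦ (φ x).incl) x₀) :
    ContMDiffAt K 𝓘(ℝ, hf.complement) ∞ φ x₀ := by
  rw [contMDiffAt_iff_target]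
  refine ⟨isInducing_incl.continuousAt_iff.2 h.continuousAt, ?_⟩
  -- The chart of the fibre is the restriction of `coord`, which is smooth on an open subset of the
  -- total space.
  exact ContMDiffAt.comp (g := coord hf (φ x₀).incl) (f := fun x ↦ (φ x).incl) x₀
    (contMDiffAt_coord (normalForm hf (φ x₀).incl).mem_domChart_source) h

/-- A family of tangent vectors of a fibre is smooth if it is smooth as a family of tangent vectors
of the total space. -/
lemma contMDiffAt_tangent_of_incl [I.Boundaryless] [IsManifold I ∞ M] [IsManifold K ∞ P]
    {φ : P → SubmersionFiber hf y}
    {v : Π x, TangentSpace 𝓘(ℝ, hf.complement) (φ x)} {x₀ : P}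
    (h : ContMDiffAt K I.tangent ∞ (fun x ↦ (⟨(φ x).incl,
      mfderiv 𝓘(ℝ, hf.complement) I incl (φ x) (v x)⟩ : TangentBundle I M)) x₀) :
    ContMDiffAt K 𝓘(ℝ, hf.complement).tangent ∞
      (fun x ↦ (⟨φ x, v x⟩ : TangentBundle 𝓘(ℝ, hf.complement) (SubmersionFiber hf y))) x₀ := by
  have hφ : ContMDiffAt K 𝓘(ℝ, hf.complement) ∞ φ x₀ :=
    contMDiffAt_of_incl (Bundle.contMDiffAt_totalSpace.1 h).1
  set c := chart (φ x₀)
  have hx₀ : φ x₀ ∈ c.source := (normalForm hf (φ x₀).incl).mem_domChart_source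
  -- The vectors are pushed from the total space to the coordinate space by `coord`, then back to
  -- the fibre by `c.symm`. The composite with the inclusion is the identity near `φ x₀`, so this
  -- recovers `v`.
  have h1 := ContMDiffAt.mfderiv_comp_apply (J := 𝓘(ℝ, hf.complement))
    (f := coord hf (φ x₀).incl) (g := fun x ↦ (φ x).incl) (contMDiffAt_coord hx₀) h
  have hsymm : ∀ w ∈ c.target, ContMDiffAt 𝓘(ℝ, hf.complement) 𝓘(ℝ, hf.complement) ∞ c.symm w :=
    fun w hw ↦ (contMDiffOn_chart_symm (I := 𝓘(ℝ, hf.complement)) (n := ∞)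
      (x := φ x₀)).contMDiffAt (c.open_target.mem_nhds hw)
  have h2 := ContMDiffAt.mfderiv_comp_apply (f := c.symm)
    (g := fun x ↦ coord hf (φ x₀).incl (φ x).incl) (hsymm _ (c.map_source hx₀)) h1
  refine h2.congr_of_eventuallyEq ?_
  filter_upwards [hφ.continuousAt.preimage_mem_nhds (c.open_source.mem_nhds hx₀)] with x hx
  have hx : φ x ∈ c.source := hx
  refine tangentBundle_mk_congr (c.left_inv hx).symm ?_
  have hcd : MDifferentiableAt I 𝓘(ℝ, hf.complement) (coord hf (φ x₀).incl) (φ x).incl :=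
    (contMDiffAt_coord hx).mdifferentiableAt (by simp)
  have hcd' := hcd.comp (φ x) (mdifferentiableAt_incl (φ x))
  have d1 := mfderiv_comp_apply (φ x) hcd (mdifferentiableAt_incl (φ x)) (v x)
  have d2 := mfderiv_comp_apply (φ x)
    ((hsymm _ (c.map_source hx)).mdifferentiableAt (by simp)) hcd' (v x)
  have e : c.symm ∘ (coord hf (φ x₀).incl ∘ incl) =ᶠ[𝓝 (φ x)] id := by
    filter_upwards [c.open_source.mem_nhds hx] with z hz
    exact c.left_inv hz
  have d3 := (DFunLike.congr_fun (e.mfderiv_eq (I := 𝓘(ℝ, hf.complement))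
    (I' := 𝓘(ℝ, hf.complement))) (v x)).symm.trans d2
  refine (DFunLike.congr_fun (mfderiv_id (I := 𝓘(ℝ, hf.complement)) (x := φ x)) (v x)).symm.trans
    (d3.trans (congrArg _ d1))

/-- The map taking `w` to the vertical vector at `z` with the coordinate `w` along the fibre in the
submersion chart at `x`. -/
def vertical (hf : IsSubmersion I J ∞ f) (x z : M) : hf.complement →L[ℝ] TangentSpace I z :=
  mfderiv 𝓘(ℝ, hf.complement) I (point hf x (f z)) (coord hf x z)

lemma contMDiffAt_point_right [I.Boundaryless] {x z : M}
    (hz : z ∈ (normalForm hf x).domChart.source) :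
    ContMDiffAt 𝓘(ℝ, hf.complement) I ∞ (point hf x (f z)) (coord hf x z) :=
  (contMDiffOn_point_right x (f z)).contMDiffAt
    (((isOpen_pointDomain x).preimage (Continuous.prodMk_right _)).mem_nhds (mem_pointDomain hz))

/-- Moving the fibre coordinate at fixed base value keeps `f` constant, so the derivative of `f ∘
point` vanishes. -/
lemma vertical_mem [I.Boundaryless] {x z : M} (hz : z ∈ (normalForm hf x).domChart.source)
    (w : hf.complement) : vertical hf x z w ∈ verticalSpace I J f z := by
  have h1 : MDifferentiableAt I J f z := hf.contMDiff.mdifferentiableAt (by simp)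
  have h2 := (contMDiffAt_point_right hz).mdifferentiableAt (by simp)
  have h3 := mfderiv_comp_apply_of_eq _ h1 h2 (point_coord hz) w
  have h4 : f ∘ point hf x (f z) =ᶠ[𝓝 (coord hf x z)] fun _ ↦ f z := by
    filter_upwards [((isOpen_pointDomain x).preimage (Continuous.prodMk_right (f z))).mem_nhds
      (mem_pointDomain hz)] with v hv
    exact map_point (p := (f z, v)) hv
  refine h3.symm.trans ?_
  refine (DFunLike.congr_fun (h4.mfderiv_eq (I := 𝓘(ℝ, hf.complement)) (I' := J)) w).trans ?_
  exact DFunLike.congr_fun (mfderiv_const (I := 𝓘(ℝ, hf.complement)) (I' := J)) w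

/-- A vertical vector is tangent to the fibre through `z`, and `point ∘ coord ∘ incl = incl` near
`z` on that fibre; the chain rule does the rest. Consequently the vectors `vertical hf x z w`
exhaust the vertical space. -/
lemma vertical_mfderiv_coord [I.Boundaryless] [IsManifold I ∞ M] {x z : M}
    (hz : z ∈ (normalForm hf x).domChart.source) {v : TangentSpace I z}
    (hv : v ∈ verticalSpace I J f z) :
    vertical hf x z (mfderiv I 𝓘(ℝ, hf.complement) (coord hf x) z v) = v := by
  let z' : SubmersionFiber hf (f z) := ⟨z, rfl⟩
  obtain ⟨u, hu⟩ := inclDeriv_surjective z' ⟨v, hv⟩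
  have hu' : mfderiv 𝓘(ℝ, hf.complement) I incl z' u = v := congrArg Subtype.val hu
  have hcd : MDifferentiableAt I 𝓘(ℝ, hf.complement) (coord hf x) z :=
    (contMDiffAt_coord hz).mdifferentiableAt (by simp)
  have hin := mdifferentiableAt_incl z'
  have hp := (contMDiffAt_point_right hz).mdifferentiableAt (by simp)
  have d1 := mfderiv_comp_apply z' hcd hin u
  have d2 := mfderiv_comp_apply z' hp (hcd.comp z' hin) u
  have e : point hf x (f z) ∘ (coord hf x ∘ incl) =ᶠ[𝓝 z'] incl := by
    filter_upwards [isInducing_incl.continuous.continuousAt.preimage_mem_nhds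
      (source_mem_nhds hz)] with w hw
    exact point_coord_incl hw
  have d3 := (DFunLike.congr_fun (e.mfderiv_eq (I := 𝓘(ℝ, hf.complement)) (I' := I)) u).symm.trans d2
  have d4 : mfderiv 𝓘(ℝ, hf.complement) 𝓘(ℝ, hf.complement) (coord hf x ∘ incl) z' u =
      mfderiv I 𝓘(ℝ, hf.complement) (coord hf x) z v := d1.trans (congrArg _ hu')
  exact (congrArg (mfderiv 𝓘(ℝ, hf.complement) I (point hf x (f z)) (coord hf x z))
    d4).symm.trans (d3.symm.trans hu')

/-- The maps `point hf x (f z)` depend smoothly on `z` jointly with the fibre coordinate, so their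
derivatives in a fixed direction `w` form a smooth family. A basis of `hf.complement` thus yields a
smooth local frame of the vertical bundle. -/
lemma contMDiffAt_vertical [I.Boundaryless] [IsManifold I ∞ M] {x z : M}
    (hz : z ∈ (normalForm hf x).domChart.source) (w : hf.complement) :
    ContMDiffAt I I.tangent ∞ (fun z ↦ (⟨z, vertical hf x z w⟩ : TangentBundle I M)) z := by
  have h1 : ContMDiffAt (I.prod 𝓘(ℝ, hf.complement)) I ∞
      (uncurry fun z v ↦ point hf x (f z) v) (z, coord hf x z) := by
    have h2 : ContMDiffAt (I.prod 𝓘(ℝ, hf.complement)) (J.prod 𝓘(ℝ, hf.complement)) ∞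
        (fun q : M × hf.complement ↦ (f q.1, q.2)) (z, coord hf x z) :=
      ((hf.contMDiff.comp contMDiff_fst).prodMk contMDiff_snd).contMDiffAt
    exact ContMDiffAt.comp (g := fun p : N × hf.complement ↦ point hf x p.1 p.2)
      (f := fun q : M × hf.complement ↦ (f q.1, q.2)) (z, coord hf x z)
      ((contMDiffOn_point x).contMDiffAt ((isOpen_pointDomain x).mem_nhds (mem_pointDomain hz))) h2
  have h3 := ContMDiffAt.mfderiv_family_apply (I := 𝓘(ℝ, hf.complement))
    (f := fun z v ↦ point hf x (f z) v) (g := coord hf x) (v := fun _ ↦ w) h1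
    (contMDiffAt_tangentBundle_vectorSpace_iff.2 ⟨contMDiffAt_coord hz, contMDiffAt_const⟩)
  refine h3.congr_of_eventuallyEq ?_
  filter_upwards [source_mem_nhds hz] with z hz
  exact tangentBundle_mk_congr (point_coord hz).symm rfl

end SubmersionFiber

open SubmersionFiber in
/-- Let `α` be a family of alternating forms on the vertical spaces of a submersion `f`, taken
along a map `σ`, which takes smooth local sections to smooth functions. Then it also takes smooth
families of vertical vectors to smooth functions. -/
lemma contMDiffAt_verticalForm_apply [I.Boundaryless] [IsManifold I ∞ M] [IsManifold K ∞ P]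
    [FiniteDimensional ℝ E] (hf : IsSubmersion I J ∞ f) {σ : Q → M} (hσ : ContMDiff K' I ∞ σ)
    {k : ℕ} {α : Π q, verticalSpace I J f (σ q) [⋀^Fin k]→L[ℝ] ℝ}
    (hα : ∀ U : Set Q, IsOpen U → ∀ X : Fin k → Π q, verticalSpace I J f (σ q),
      (∀ i, ContMDiffOn K' I.tangent ∞ (fun q ↦ (⟨σ q, X i q⟩ : TangentBundle I M)) U) →
      ContMDiffOn K' 𝓘(ℝ, ℝ) ∞ (fun q ↦ α q (fun i ↦ X i q)) U)
    {b : P → Q} {m₀ : P} (hb : ContMDiffAt K K' ∞ b m₀)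
    {v : Fin k → Π m, verticalSpace I J f (σ (b m))}
    (hv : ∀ i, ContMDiffAt K I.tangent ∞
      (fun m ↦ (⟨σ (b m), v i m⟩ : TangentBundle I M)) m₀) :
    ContMDiffAt K 𝓘(ℝ, ℝ) ∞ (fun m ↦ α (b m) (fun i ↦ v i m)) m₀ := by
  classical
  have : Nonempty M := ⟨σ (b m₀)⟩
  set x := σ (b m₀)
  have hxs : x ∈ (normalForm hf x).domChart.source := (normalForm hf x).mem_domChart_source
  set S := (normalForm hf x).domChart.source
  set B := Module.finBasis ℝ hf.complement
  set U : Set Q := σ ⁻¹' S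
  have hUo : IsOpen U := (normalForm hf x).domChart.open_source.preimage hσ.continuous
  -- The vertical coordinate frame along `σ`. The value `0` outside `U` only makes it globally
  -- defined, since `hα` asks for smoothness on `U` alone.
  let e : Fin (Module.finrank ℝ hf.complement) → Π q, verticalSpace I J f (σ q) := fun j q ↦
    if hq : σ q ∈ S then ⟨vertical hf x (σ q) (B j), vertical_mem hq _⟩ else 0
  have he : ∀ j q, (hq : σ q ∈ S) → e j q = ⟨vertical hf x (σ q) (B j), vertical_mem hq _⟩ :=
    fun j q hq ↦ dif_pos hq
  have hes : ∀ j, ContMDiffOn K' I.tangent ∞ (fun q ↦ (⟨σ q, e j q⟩ : TangentBundle I M)) U := by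
    intro j q hq
    refine (((contMDiffAt_vertical hq (B j)).comp q hσ.contMDiffAt).congr_of_eventuallyEq
      ?_).contMDiffWithinAt
    filter_upwards [hUo.mem_nhds hq] with q' hq'
    rw [he j q' hq']
    rfl
  let c : Fin k → Fin (Module.finrank ℝ hf.complement) → P → ℝ := fun i j m ↦
    B.coord j (mfderiv I 𝓘(ℝ, hf.complement) (coord hf x) (σ (b m)) (v i m))
  have hc : ∀ i j, ContMDiffAt K 𝓘(ℝ, ℝ) ∞ (c i j) m₀ := by
    intro i j
    have h1 := (contMDiffAt_tangentBundle_vectorSpace_iff.1 (ContMDiffAt.mfderiv_comp_apply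
      (J := 𝓘(ℝ, hf.complement)) (f := coord hf x) (g := fun m ↦ σ (b m))
      (contMDiffAt_coord hxs) (hv i))).2
    exact ContMDiffAt.comp (I' := 𝓘(ℝ, hf.complement)) (g := (B.coord j).toContinuousLinearMap)
      m₀ ((B.coord j).toContinuousLinearMap.contDiff.contMDiff.contMDiffAt) h1
  have hmem : ∀ᶠ m in 𝓝 m₀, σ (b m) ∈ S :=
    (hσ.continuous.continuousAt.comp hb.continuousAt).preimage_mem_nhds (source_mem_nhds hxs)
  -- In this frame the `v i` have the smooth coefficients `c i`. Multilinearity leaves only values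
  -- of `α` on frame sections, to which `hα` applies.
  have key : ∀ᶠ m in 𝓝 m₀, α (b m) (fun i ↦ v i m) =
      ∑ r : Fin k → Fin (Module.finrank ℝ hf.complement),
        (∏ i, c i (r i) m) * α (b m) (fun i ↦ e (r i) (b m)) := by
    filter_upwards [hmem] with m hm
    rw [← ContinuousAlternatingMap.map_sum_smul (α (b m)) (fun i j ↦ c i j m)
      (fun j ↦ e j (b m))]
    congr 1
    funext i
    apply Subtype.ext
    have h1 := vertical_mfderiv_coord hm (v i m).2
    have h2 : ∀ w : hf.complement, vertical hf x (σ (b m)) w =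
        ∑ j, B.coord j w • vertical hf x (σ (b m)) (B j) := by
      intro w
      conv_lhs => rw [← B.sum_repr w]
      rw [map_sum]
      exact Finset.sum_congr rfl fun j _ ↦ map_smul _ _ _
    refine (h1.symm.trans (h2 _)).trans ?_
    simp only [he _ _ hm, Submodule.coe_sum, Submodule.coe_smul]
    rfl
  refine ContMDiffAt.congr_of_eventuallyEq ?_ key
  refine ContMDiffAt.sum fun r _ ↦ ?_
  refine ContMDiffAt.mul (contMDiffAt_finsetProd fun i _ ↦ hc i (r i)) ?_
  exact ContMDiffAt.comp (g := fun q ↦ α q fun i ↦ e (r i) q) m₀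
    ((hα U hUo (fun i ↦ e (r i)) (fun i ↦ hes (r i))).contMDiffAt (hUo.mem_nhds hxs)) hb

end SubmersionFiberFrame

/-! ### Lie brackets of related vector fields and the invariant formula for the exterior derivative.
-/

section Brackets

variable {E : Type*} [NormedAddCommGroup E] [NormedSpace ℝ E] {H : Type*} [TopologicalSpace H]
  {E' : Type*} [NormedAddCommGroup E'] [NormedSpace ℝ E'] {H' : Type*} [TopologicalSpace H']
  {J : ModelWithCorners ℝ E' H'} {N : Type*} [TopologicalSpace N] [ChartedSpace H' N]
  {I : ModelWithCorners ℝ E H} {M : Type*} [TopologicalSpace M] [ChartedSpace H M]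

/-- The expression of a vector field in the chart around `x₀`. -/
def fieldInChart (I : ModelWithCorners ℝ E H) (V : Π x : M, TangentSpace I x) (x₀ : M) : E → E :=
  VectorField.mpullbackWithin 𝓘(ℝ, E) I (extChartAt I x₀).symm V (range I)

lemma mfderivWithin_fieldInChart [IsManifold I ∞ M] (V : Π x : M, TangentSpace I x) (x₀ : M)
    {y : E} (hy : y ∈ (extChartAt I x₀).target) :
    mfderivWithin 𝓘(ℝ, E) I (extChartAt I x₀).symm (range I) y
      (fieldInChart (E := E) I V x₀ y) =
      V ((extChartAt I x₀).symm y) :=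
  (isInvertible_mfderivWithin_extChartAt_symm (I := I) hy).self_apply_inverse _

lemma fieldInChart_apply [IsManifold I ∞ M] (V : Π x : M, TangentSpace I x) (x₀ : M)
    {z : M} (hz : z ∈ (extChartAt I x₀).source) :
    fieldInChart I V x₀ (extChartAt I x₀ z) = mfderiv I 𝓘(ℝ, E) (extChartAt I x₀) z (V z) := by
  have h1 := mfderivWithin_fieldInChart V x₀ ((extChartAt I x₀).map_source hz)
  have h2 := mfderiv_extChartAt_comp_mfderivWithin_extChartAt_symm' (I := I) hz
  have h3 := DFunLike.congr_fun h2 (fieldInChart I V x₀ (extChartAt I x₀ z))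
  refine h3.symm.trans ?_
  exact congrArg (mfderiv I 𝓘(ℝ, E) (extChartAt I x₀) z)
    (h1.trans (congrArg (fun w ↦ (V w : E)) ((extChartAt I x₀).left_inv hz)))

lemma mfderivWithin_extChartAt_symm_mfderiv [IsManifold I ∞ M] {x₀ : M}
    {z : M} (hz : z ∈ (extChartAt I x₀).source) (v : TangentSpace I z) :
    mfderivWithin 𝓘(ℝ, E) I (extChartAt I x₀).symm (range I) (extChartAt I x₀ z)
      (mfderiv I 𝓘(ℝ, E) (extChartAt I x₀) z v) = v :=
  DFunLike.congr_fun (mfderivWithin_extChartAt_symm_comp_mfderiv_extChartAt' (I := I) hz) v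

lemma differentiableAt_fieldInChart [I.Boundaryless] [CompleteSpace E] [IsManifold I ∞ M]
    {V : Π x : M, TangentSpace I x} {x₀ : M}
    (hV : MDifferentiableAt I I.tangent (fun x ↦ (⟨x, V x⟩ : TangentBundle I M)) x₀) :
    DifferentiableAt ℝ (fieldInChart I V x₀) (extChartAt I x₀ x₀) := by
  have h : DifferentiableWithinAt ℝ (fieldInChart I V x₀)
      ((extChartAt I x₀).symm ⁻¹' univ ∩ range I) (extChartAt I x₀ x₀) :=
    (hV.mdifferentiableWithinAt (s := univ)).differentiableWithinAt_mpullbackWithin_vectorField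
  rwa [I.range_eq_univ, preimage_univ, univ_inter, differentiableWithinAt_univ] at h

/-- The manifold bracket is the chart bracket pulled back by the derivative of the chart, and at the
centre of the chart this derivative is the identity. -/
lemma mlieBracket_eq_lieBracket_fieldInChart [I.Boundaryless] [IsManifold I ∞ M]
    (V W : Π x : M, TangentSpace I x) (x₀ : M) :
    VectorField.mlieBracket I V W x₀ = VectorField.lieBracket ℝ (fieldInChart I V x₀)
      (fieldInChart I W x₀) (extChartAt I x₀ x₀) := by
  rw [← VectorField.mlieBracketWithin_univ, VectorField.mlieBracketWithin_apply,
    mfderiv_extChartAt_self, preimage_univ, univ_inter, ← VectorField.lieBracketWithin_univ]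
  unfold fieldInChart
  rw [I.range_eq_univ]
  exact DFunLike.congr_fun (ContinuousLinearMap.inverse_id (R := ℝ) (M := E)) _

/-- If two vector fields are related to two other vector fields by a smooth map, then so are the
Lie brackets. -/
lemma mfderiv_mlieBracket_of_related [I.Boundaryless] [J.Boundaryless] [CompleteSpace E]
    [CompleteSpace E'] [IsManifold I ∞ M] [IsManifold J ∞ N] {f : M → N} (hf : ContMDiff I J ∞ f)
    {V W : Π x : M, TangentSpace I x} {V' W' : Π y : N, TangentSpace J y} {x : M}
    (hV : MDifferentiableAt I I.tangent (fun x ↦ (⟨x, V x⟩ : TangentBundle I M)) x)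
    (hW : MDifferentiableAt I I.tangent (fun x ↦ (⟨x, W x⟩ : TangentBundle I M)) x)
    (hV' : MDifferentiableAt J J.tangent (fun y ↦ (⟨y, V' y⟩ : TangentBundle J N)) (f x))
    (hW' : MDifferentiableAt J J.tangent (fun y ↦ (⟨y, W' y⟩ : TangentBundle J N)) (f x))
    (hVV' : ∀ x, mfderiv I J f x (V x) = V' (f x))
    (hWW' : ∀ x, mfderiv I J f x (W x) = W' (f x)) :
    mfderiv I J f x (VectorField.mlieBracket I V W x) = VectorField.mlieBracket J V' W' (f x) := by
  set g : E → E' := writtenInExtChartAt I J x f with hg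
  set y₀ := extChartAt I x x with hy₀
  have hgy₀ : g y₀ = extChartAt J (f x) (f x) := by simp [hg, hy₀, writtenInExtChartAt]
  have hgc : ContDiffAt ℝ ∞ g y₀ := by
    have := (contMDiffAt_iff.1 (hf x)).2
    rwa [I.range_eq_univ, contDiffWithinAt_univ] at this
  have rel : ∀ (U : Π x : M, TangentSpace I x) (U' : Π y : N, TangentSpace J y),
      (∀ x, mfderiv I J f x (U x) = U' (f x)) →
      (fun y ↦ fderiv ℝ g y (fieldInChart I U x y)) =ᶠ[𝓝 y₀]
        fun y ↦ fieldInChart J U' (f x) (g y) := by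
    intro U U' hU
    have hcont : ContinuousAt (f ∘ (extChartAt I x).symm) y₀ :=
      ContinuousAt.comp (by simpa [hy₀] using hf.continuous.continuousAt)
        (continuousAt_extChartAt_symm x)
    have hsrc : (f ∘ (extChartAt I x).symm) ⁻¹' (extChartAt J (f x)).source ∈ 𝓝 y₀ :=
      hcont.preimage_mem_nhds (by simpa [hy₀] using extChartAt_source_mem_nhds (I := J) (f x))
    filter_upwards [extChartAt_target_mem_nhds x, hsrc] with y hy hy'
    have hs : MDifferentiableAt 𝓘(ℝ, E) I (extChartAt I x).symm y := by
      have := mdifferentiableWithinAt_extChartAt_symm (I := I) hy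
      rwa [I.range_eq_univ, mdifferentiableWithinAt_univ] at this
    have hff : MDifferentiableAt I J f ((extChartAt I x).symm y) := hf.mdifferentiableAt (by simp)
    have hc : MDifferentiableAt J 𝓘(ℝ, E') (extChartAt J (f x)) (f ((extChartAt I x).symm y)) :=
      mdifferentiableAt_extChartAt (by simpa using hy')
    have h0 := mfderivWithin_fieldInChart U x hy
    rw [I.range_eq_univ, mfderivWithin_univ] at h0
    have h1 := mfderiv_comp_apply y hff hs (fieldInChart (E := E) I U x y)
    have h2 := mfderiv_comp_apply y hc (hff.comp y hs) (fieldInChart (E := E) I U x y)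
    have h3 := fieldInChart_apply U' (f x) hy'
    refine Eq.trans ?_ (h2.trans (Eq.trans ?_ h3.symm))
    · rw [mfderiv_eq_fderiv]; rfl
    · exact congrArg _ (h1.trans ((congrArg _ h0).trans (hU _)))
  have e1 : ∀ u : TangentSpace I x, mfderiv I J f x u = fderiv ℝ g y₀ u := by
    intro u
    have := DFunLike.congr_fun
      (MDifferentiableAt.mfderiv (I := I) (I' := J) (hf.mdifferentiableAt (x := x) (by simp))) u
    rwa [I.range_eq_univ, fderivWithin_univ] at this
  have dV := differentiableAt_fieldInChart hV
  have dW := differentiableAt_fieldInChart hW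
  have dV' := differentiableAt_fieldInChart hV'
  have dW' := differentiableAt_fieldInChart hW'
  rw [← hgy₀] at dV' dW'
  have dg : DifferentiableAt ℝ g y₀ := hgc.differentiableAt (by simp)
  -- By symmetry of the second derivative, `dg [V, W]` is the derivative of `dg(W)` along `V` minus
  -- that of `dg(V)` along `W`. Relatedness replaces `dg(W)` by `W' ∘ g` and `dg(V)` by `V' ∘ g`,
  -- and the chain rule turns the difference into `[V', W']`.
  have h := VectorField.fderiv_apply_lieBracket hgc
    (by simpa [minSmoothness_of_isRCLikeNormedField] using ENat.LEInfty.out) dW dV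
  rw [(rel W W' hWW').fderiv_eq, (rel V V' hVV').fderiv_eq] at h
  have c1 := fderiv_comp y₀ dW' dg
  have c2 := fderiv_comp y₀ dV' dg
  have r1 := (rel V V' hVV').self_of_nhds
  have r2 := (rel W W' hWW').self_of_nhds
  rw [mlieBracket_eq_lieBracket_fieldInChart V W, mlieBracket_eq_lieBracket_fieldInChart V' W',
    ← hgy₀]
  refine (e1 _).trans (h.trans ?_)
  rw [VectorField.lieBracket_eq]
  refine congrArg₂ (· - ·) ?_ ?_
  · exact (DFunLike.congr_fun c1 _).trans (congrArg (fderiv ℝ (fieldInChart J W' (f x)) (g y₀)) r1)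
  · exact (DFunLike.congr_fun c2 _).trans (congrArg (fderiv ℝ (fieldInChart J V' (f x)) (g y₀)) r2)

lemma formInChart_apply_fieldInChart [IsManifold I ∞ M] {k : ℕ}
    (α : Π x : M, TangentSpace I x [⋀^Fin k]→L[ℝ] ℝ) (X : Fin k → Π x : M, TangentSpace I x)
    (x₀ : M) {y : E} (hy : y ∈ (extChartAt I x₀).target) :
    formInChart I α x₀ y (fun i ↦ fieldInChart I (X i) x₀ y) =
      α ((extChartAt I x₀).symm y) (fun i ↦ X i ((extChartAt I x₀).symm y)) :=
  congrArg (α ((extChartAt I x₀).symm y))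
    (funext fun i ↦ mfderivWithin_fieldInChart (X i) x₀ hy)

/-- It is enough to evaluate on constant vectors of the chart. These correspond to the smooth
coordinate fields `X i` on the chart domain, where smoothness of `α` can be tested. -/
lemma differentiableAt_formInChart [I.Boundaryless] [FiniteDimensional ℝ E] [IsManifold I ∞ M]
    {k : ℕ} {α : Π x : M, TangentSpace I x [⋀^Fin k]→L[ℝ] ℝ} (hα : IsSmoothForm I α) (x₀ : M) :
    DifferentiableAt ℝ (formInChart I α x₀) (extChartAt I x₀ x₀) := by
  refine ContinuousAlternatingMap.differentiableAt_of_apply fun v ↦ ?_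
  set X : Fin k → Π x : M, TangentSpace I x := fun i z ↦
    mfderivWithin 𝓘(ℝ, E) I (extChartAt I x₀).symm (range I) (extChartAt I x₀ z) (v i) with hX
  have hXs : ∀ i, ContMDiffOn I I.tangent ∞ (fun x ↦ (⟨x, X i x⟩ : TangentBundle I M))
      (extChartAt I x₀).source := by
    intro i z hz
    have h1 : ContMDiffAt 𝓘(ℝ, E) I ∞ (extChartAt I x₀).symm (extChartAt I x₀ z) :=
      (contMDiffOn_extChartAt_symm x₀).contMDiffAt
        (extChartAt_target_mem_nhds' ((extChartAt I x₀).map_source hz))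
    have h2 : ContMDiffAt I 𝓘(ℝ, E) ∞ (extChartAt I x₀) z :=
      contMDiffAt_extChartAt' (by simpa using hz)
    have h3 := ContMDiffAt.mfderiv_comp_apply (f := (extChartAt I x₀).symm) (g := extChartAt I x₀)
      (v := fun _ ↦ v i) h1 (contMDiffAt_tangentBundle_vectorSpace_iff.2 ⟨h2, contMDiffAt_const⟩)
    refine (h3.congr_of_eventuallyEq ?_).contMDiffWithinAt
    filter_upwards [(isOpen_extChartAt_source (I := I) x₀).mem_nhds hz] with z hz
    refine tangentBundle_mk_congr ((extChartAt I x₀).left_inv hz).symm ?_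
    rw [hX, I.range_eq_univ]
    simp only [mfderivWithin_univ]
    rfl
  have h1 := (hα _ (isOpen_extChartAt_source x₀) X hXs).contMDiffAt
    (extChartAt_source_mem_nhds (I := I) x₀)
  have h2 : ContMDiffAt 𝓘(ℝ, E) I ∞ (extChartAt I x₀).symm (extChartAt I x₀ x₀) :=
    (contMDiffOn_extChartAt_symm x₀).contMDiffAt (extChartAt_target_mem_nhds x₀)
  have h3 := ContMDiffAt.comp_of_eq h1 h2 (extChartAt_to_inv (I := I) x₀)
  have h4 := h3.contDiffAt.differentiableAt (by simp)
  refine h4.congr_of_eventuallyEq ?_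
  filter_upwards [extChartAt_target_mem_nhds (I := I) x₀] with y hy
  refine congrArg (α ((extChartAt I x₀).symm y)) (funext fun i ↦ ?_)
  exact congrArg (fun w ↦ (mfderivWithin 𝓘(ℝ, E) I (extChartAt I x₀).symm (range I) w : E →L[ℝ] E)
    (v i)) ((extChartAt I x₀).right_inv hy).symm

/-- The derivative of a function along a tangent vector. -/
def tangentDeriv (I : ModelWithCorners ℝ E H) (φ : M → ℝ) (x : M) (v : TangentSpace I x) : ℝ :=
  mfderiv I 𝓘(ℝ, ℝ) φ x v

lemma fderiv_comp_extChartAt_symm [I.Boundaryless] {φ : M → ℝ} {x₀ : M}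
    (hφ : MDifferentiableAt I 𝓘(ℝ, ℝ) φ x₀) (v : TangentSpace I x₀) :
    fderiv ℝ (φ ∘ (extChartAt I x₀).symm) (extChartAt I x₀ x₀) v = tangentDeriv I φ x₀ v := by
  have := DFunLike.congr_fun (MDifferentiableAt.mfderiv hφ) v
  rw [I.range_eq_univ, fderivWithin_univ] at this
  exact this.symm

/-- The exterior derivative of a smooth form in terms of vector fields. -/
lemma mextDeriv_apply_vectorField [I.Boundaryless] [FiniteDimensional ℝ E] [IsManifold I ∞ M]
    {k : ℕ} {α : Π x : M, TangentSpace I x [⋀^Fin (k + 1)]→L[ℝ] ℝ} (hα : IsSmoothForm I α)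
    {X : Fin (k + 2) → Π x : M, TangentSpace I x}
    (hX : ∀ i, ContMDiff I I.tangent ∞ (fun x ↦ (⟨x, X i x⟩ : TangentBundle I M))) (x : M) :
    mextDeriv I α x (fun i ↦ X i x) =
      (∑ i, (-1) ^ i.val • tangentDeriv I (fun z ↦ α z (i.removeNth (X · z))) x (X i x)) -
        ∑ i : Fin (k + 1), ∑ j ≥ i,
          (-1) ^ (i + j : ℕ) •
            α x (Matrix.vecCons (VectorField.mlieBracket I (X i.castSucc) (X j.succ) x)
              (j.removeNth <| i.castSucc.removeNth (X · x))) := by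
  have := FiniteDimensional.complete ℝ E
  -- At its centre the chart has derivative the identity, so the form and the fields take the same
  -- values at `x` as their chart expressions. The formula is then the one in the model space.
  have hself : ∀ v : E, (mfderiv I 𝓘(ℝ, E) (extChartAt I x) x : E →L[ℝ] E) v = v := fun v ↦
    DFunLike.congr_fun (mfderiv_extChartAt_self (I := I) (x := x)) v
  have hself' : ∀ v : E, (mfderivWithin 𝓘(ℝ, E) I (extChartAt I x).symm (range I)
      (extChartAt I x x) : E →L[ℝ] E) v = v := fun v ↦
    (congrArg _ (hself v).symm).trans
      (mfderivWithin_extChartAt_symm_mfderiv (I := I) (mem_extChartAt_source x) v)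
  have hval : ∀ V : Π x : M, TangentSpace I x, fieldInChart I V x (extChartAt I x x) = V x :=
    fun V ↦ (fieldInChart_apply V x (mem_extChartAt_source x)).trans (hself _)
  have h := extDeriv_apply_vectorField (V := fun i ↦ fieldInChart I (X i) x)
    (differentiableAt_formInChart hα x)
    fun i ↦ differentiableAt_fieldInChart ((hX i).mdifferentiableAt (by simp))
  have hform : ∀ v : Fin (k + 1) → E, formInChart I α x (extChartAt I x x) v = α x v := by
    intro v
    have e := extChartAt_to_inv (I := I) x
    have : ∀ z, z = x → ∀ w : Fin (k + 1) → E, α z w = α x w := by rintro z rfl w; rfl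
    exact (congrArg (α _) (funext fun i ↦ hself' (v i))).trans (this _ e v)
  have hd : mextDeriv I α x (fun i ↦ X i x) = extDeriv (formInChart I α x) (extChartAt I x x)
      (fun i ↦ fieldInChart I (X i) x (extChartAt I x x)) := by
    rw [mextDeriv, I.range_eq_univ, extDerivWithin_univ]
    exact congrArg _ (funext fun i ↦ (hself _).trans (hval (X i)).symm)
  rw [hd, h]
  refine congrArg₂ (· - ·) (Finset.sum_congr rfl fun i _ ↦ ?_)
    (Finset.sum_congr rfl fun i _ ↦ Finset.sum_congr rfl fun j _ ↦ ?_)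
  · congr 1
    have hs : ContMDiff I 𝓘(ℝ, ℝ) ∞ (fun z ↦ α z (i.removeNth (X · z))) :=
      contMDiffOn_univ.1 (hα univ isOpen_univ (fun j ↦ X (i.succAbove j))
        fun j ↦ (hX _).contMDiffOn)
    rw [← fderiv_comp_extChartAt_symm (hs.mdifferentiableAt (by simp)), hval]
    refine DFunLike.congr_fun (Filter.EventuallyEq.fderiv_eq ?_) _
    filter_upwards [extChartAt_target_mem_nhds (I := I) x] with y hy
    exact formInChart_apply_fieldInChart α (fun j ↦ X (i.succAbove j)) x hy
  · congr 1
    rw [hform]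
    refine congrArg (α x) ?_
    rw [mlieBracket_eq_lieBracket_fieldInChart]
    refine congrArg _ (funext fun l ↦ ?_)
    exact hval _

/-- The exterior derivative of a smooth 2-form in terms of vector fields. -/
lemma mextDeriv_apply_vectorField_two [I.Boundaryless] [FiniteDimensional ℝ E] [IsManifold I ∞ M]
    {α : Π x : M, TangentSpace I x [⋀^Fin 2]→L[ℝ] ℝ} (hα : IsSmoothForm I α)
    {X Y Z : Π x : M, TangentSpace I x}
    (hX : ContMDiff I I.tangent ∞ (fun x ↦ (⟨x, X x⟩ : TangentBundle I M)))
    (hY : ContMDiff I I.tangent ∞ (fun x ↦ (⟨x, Y x⟩ : TangentBundle I M)))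
    (hZ : ContMDiff I I.tangent ∞ (fun x ↦ (⟨x, Z x⟩ : TangentBundle I M))) (x : M) :
    mextDeriv I α x ![X x, Y x, Z x] =
      tangentDeriv I (fun z ↦ α z ![Y z, Z z]) x (X x)
      - tangentDeriv I (fun z ↦ α z ![X z, Z z]) x (Y x)
      + tangentDeriv I (fun z ↦ α z ![X z, Y z]) x (Z x)
      - α x ![VectorField.mlieBracket I X Y x, Z x]
      + α x ![VectorField.mlieBracket I X Z x, Y x]
      - α x ![VectorField.mlieBracket I Y Z x, X x] := by
  have h := mextDeriv_apply_vectorField hα (X := ![X, Y, Z])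
    (by intro i; fin_cases i; exacts [hX, hY, hZ]) x
  have e0 : (fun i ↦ (![X, Y, Z] : Fin 3 → Π x : M, TangentSpace I x) i x) =
      ![X x, Y x, Z x] := by funext i; fin_cases i <;> rfl
  have r0 : ∀ z, (0 : Fin 3).removeNth (fun i ↦ (![X, Y, Z] : Fin 3 → Π x : M, TangentSpace I x) i z)
      = ![Y z, Z z] := by intro z; funext i; fin_cases i <;> rfl
  have r1 : ∀ z, (1 : Fin 3).removeNth (fun i ↦ (![X, Y, Z] : Fin 3 → Π x : M, TangentSpace I x) i z)
      = ![X z, Z z] := by intro z; funext i; fin_cases i <;> rfl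
  have r2 : ∀ z, (2 : Fin 3).removeNth (fun i ↦ (![X, Y, Z] : Fin 3 → Π x : M, TangentSpace I x) i z)
      = ![X z, Y z] := by intro z; funext i; fin_cases i <;> rfl
  -- A pair `j ≥ i` stands for the bracket of the fields numbered `i` and `j + 1`, so `(0,0)`,
  -- `(0,1)`, `(1,1)` give `[X, Y]`, `[X, Z]`, `[Y, Z]`, with signs `+`, `-`, `+` inside the
  -- subtracted sum.
  have s0 : Finset.Ici (0 : Fin 2) = {0, 1} := by decide
  have s1 : Finset.Ici (1 : Fin 2) = {1} := by decide
  rw [e0, Fin.sum_univ_three, Fin.sum_univ_two, s0, s1, Finset.sum_pair (by decide),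
    Finset.sum_singleton] at h
  simp only [r0, r1, r2, Fin.castSucc_zero, Fin.castSucc_one] at h
  have t0 : (0 : Fin 2).removeNth ((0 : Fin 3).removeNth ![X x, Y x, Z x]) = ![Z x] := by
    funext i; fin_cases i; rfl
  have t1 : (1 : Fin 2).removeNth ((0 : Fin 3).removeNth ![X x, Y x, Z x]) = ![Y x] := by
    funext i; fin_cases i; rfl
  have t2 : (1 : Fin 2).removeNth ((1 : Fin 3).removeNth ![X x, Y x, Z x]) = ![X x] := by
    funext i; fin_cases i; rfl
  rw [t0, t1, t2] at h
  have signs : ∀ a b c d e f : ℝ,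
      (-1 : ℤ) ^ ((0 : Fin 3) : ℕ) • a + (-1 : ℤ) ^ ((1 : Fin 3) : ℕ) • b +
        (-1 : ℤ) ^ ((2 : Fin 3) : ℕ) • c -
        ((-1 : ℤ) ^ ((0 : Fin 2) + (0 : Fin 2) : ℕ) • d +
          (-1 : ℤ) ^ ((0 : Fin 2) + (1 : Fin 2) : ℕ) • e +
          (-1 : ℤ) ^ ((1 : Fin 2) + (1 : Fin 2) : ℕ) • f) = a - b + c - d + e - f := by
    intro a b c d e f
    simp
    ring
  exact h.trans (signs _ _ _ _ _ _)

end Brackets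

/-! ### Left translations between the fibres of `t`, and left-invariant vector fields on them. -/

namespace LieGroupoid

variable {E : Type u} [NormedAddCommGroup E] [NormedSpace ℝ E]
  {H : Type*} [TopologicalSpace H] {I : ModelWithCorners ℝ E H}
  {E' : Type*} [NormedAddCommGroup E'] [NormedSpace ℝ E']
  {H' : Type*} [TopologicalSpace H'] {J : ModelWithCorners ℝ E' H'}
  {G : Type*} [TopologicalSpace G] [ChartedSpace H G]
  {M : Type*} [TopologicalSpace M] [ChartedSpace H' M]
  (𝒢 : LieGroupoid I J G M) [IsManifold I ∞ G]

/-- Left multiplication by an arrow `g` from `p` to `q`, as a map `t⁻¹(p) → t⁻¹(q)`. -/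
def leftMulTo (g : G) {p q : M} (hp : 𝒢.source g = p) (hq : 𝒢.target g = q) (h : 𝒢.tFiber p) :
    𝒢.tFiber q :=
  ⟨𝒢.mul g h.incl, (𝒢.target_mul _ _ (hp.trans h.map_incl.symm)).trans hq⟩

variable {𝒢} {g k : G} {p q r : M}

lemma leftMulTo_unitPoint (hp : 𝒢.source g = p) (hq : 𝒢.target g = q) :
    𝒢.leftMulTo g hp hq (𝒢.unitPoint p) = ⟨g, hq⟩ := by
  subst hp
  exact SubmersionFiber.incl_injective (𝒢.mul_unit g)

/-- Associativity of the multiplication. Keeping the endpoints as variables with equations lets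
translations be composed although `source (mul g k)` and `source k` are only propositionally equal.
-/
lemma leftMulTo_comp (hp : 𝒢.source k = p) (hq : 𝒢.target k = q) (hq' : 𝒢.source g = q)
    (hr : 𝒢.target g = r) (h : 𝒢.tFiber p) :
    𝒢.leftMulTo g hq' hr (𝒢.leftMulTo k hp hq h) =
      𝒢.leftMulTo (𝒢.mul g k) ((𝒢.source_mul _ _ (hq'.trans hq.symm)).trans hp)
        ((𝒢.target_mul _ _ (hq'.trans hq.symm)).trans hr) h :=
  SubmersionFiber.incl_injective
    (𝒢.mul_assoc _ _ _ (hq'.trans hq.symm) (hp.trans h.map_incl.symm)).symm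

lemma leftMulTo_inv_leftMulTo (hp : 𝒢.source g = p) (hq : 𝒢.target g = q) (h : 𝒢.tFiber p) :
    𝒢.leftMulTo (𝒢.inv g) ((𝒢.source_inv g).trans hq) ((𝒢.target_inv g).trans hp)
      (𝒢.leftMulTo g hp hq h) = h := by
  subst hp
  rw [leftMulTo_comp]
  apply SubmersionFiber.incl_injective
  have h1 := 𝒢.unit_mul h.incl
  rw [h.map_incl, ← 𝒢.inv_mul g] at h1
  exact h1

lemma leftMulTo_leftMulTo_inv (hp : 𝒢.source g = p) (hq : 𝒢.target g = q) (h : 𝒢.tFiber q) :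
    𝒢.leftMulTo g hp hq (𝒢.leftMulTo (𝒢.inv g) ((𝒢.source_inv g).trans hq)
      ((𝒢.target_inv g).trans hp) h) = h := by
  subst hq
  rw [leftMulTo_comp]
  apply SubmersionFiber.incl_injective
  have h1 := 𝒢.unit_mul h.incl
  rw [h.map_incl, ← 𝒢.mul_inv g] at h1
  exact h1

/-- Every point of `t⁻¹(q)` is of the form `l_g(1_p)`. -/
lemma leftMulTo_incl_unitPoint (x : 𝒢.tFiber q) :
    𝒢.leftMulTo x.incl rfl x.map_incl (𝒢.unitPoint (𝒢.source x.incl)) = x :=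
  leftMulTo_unitPoint rfl x.map_incl

variable [I.Boundaryless]

lemma contMDiff_leftMulTo (hp : 𝒢.source g = p) (hq : 𝒢.target g = q) :
    ContMDiff 𝓘(ℝ, 𝒢.tModel) 𝓘(ℝ, 𝒢.tModel) ∞ (𝒢.leftMulTo g hp hq) := by
  subst hp
  exact fun h ↦ SubmersionFiber.contMDiffAt_of_incl (𝒢.contMDiff_incl_leftMul g h)

lemma mdifferentiableAt_leftMulTo (hp : 𝒢.source g = p) (hq : 𝒢.target g = q) (h : 𝒢.tFiber p) :
    MDifferentiableAt 𝓘(ℝ, 𝒢.tModel) 𝓘(ℝ, 𝒢.tModel) (𝒢.leftMulTo g hp hq) h :=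
  (contMDiff_leftMulTo hp hq).mdifferentiableAt (by simp)

lemma mfderiv_leftMulTo_inv_apply (hp : 𝒢.source g = p) (hq : 𝒢.target g = q) (h : 𝒢.tFiber p)
    (v : TangentSpace 𝓘(ℝ, 𝒢.tModel) h) :
    mfderiv 𝓘(ℝ, 𝒢.tModel) 𝓘(ℝ, 𝒢.tModel)
      (𝒢.leftMulTo (𝒢.inv g) ((𝒢.source_inv g).trans hq) ((𝒢.target_inv g).trans hp))
      (𝒢.leftMulTo g hp hq h)
      (mfderiv 𝓘(ℝ, 𝒢.tModel) 𝓘(ℝ, 𝒢.tModel) (𝒢.leftMulTo g hp hq) h v) = v := by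
  refine (mfderiv_comp_apply h (mdifferentiableAt_leftMulTo _ _ _)
    (mdifferentiableAt_leftMulTo hp hq h) v).symm.trans ?_
  have e : 𝒢.leftMulTo (𝒢.inv g) ((𝒢.source_inv g).trans hq) ((𝒢.target_inv g).trans hp) ∘
      𝒢.leftMulTo g hp hq = id := funext fun h ↦ leftMulTo_inv_leftMulTo hp hq h
  rw [e]
  exact DFunLike.congr_fun (mfderiv_id (I := 𝓘(ℝ, 𝒢.tModel)) (x := h)) v

/-- The chain rule for `l_g l_k = l_{gk}`. The intermediate point is a variable `h'`, so that it
need not be literally of the form `leftMulTo k hp hq h`. -/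
lemma mfderiv_leftMulTo_comp_apply (hp : 𝒢.source k = p) (hq : 𝒢.target k = q)
    (hq' : 𝒢.source g = q) (hr : 𝒢.target g = r) {h : 𝒢.tFiber p} {h' : 𝒢.tFiber q}
    (hh' : 𝒢.leftMulTo k hp hq h = h') (v : TangentSpace 𝓘(ℝ, 𝒢.tModel) h) :
    mfderiv 𝓘(ℝ, 𝒢.tModel) 𝓘(ℝ, 𝒢.tModel) (𝒢.leftMulTo g hq' hr) h'
      (mfderiv 𝓘(ℝ, 𝒢.tModel) 𝓘(ℝ, 𝒢.tModel) (𝒢.leftMulTo k hp hq) h v : 𝒢.tModel) =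
    mfderiv 𝓘(ℝ, 𝒢.tModel) 𝓘(ℝ, 𝒢.tModel)
      (𝒢.leftMulTo (𝒢.mul g k) ((𝒢.source_mul _ _ (hq'.trans hq.symm)).trans hp)
        ((𝒢.target_mul _ _ (hq'.trans hq.symm)).trans hr)) h v := by
  subst hh'
  refine (mfderiv_comp_apply h (mdifferentiableAt_leftMulTo _ _ _)
    (mdifferentiableAt_leftMulTo hp hq h) v).symm.trans ?_
  have e : 𝒢.leftMulTo g hq' hr ∘ 𝒢.leftMulTo k hp hq =
      𝒢.leftMulTo (𝒢.mul g k) ((𝒢.source_mul _ _ (hq'.trans hq.symm)).trans hp)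
        ((𝒢.target_mul _ _ (hq'.trans hq.symm)).trans hr) :=
    funext fun h ↦ leftMulTo_comp hp hq hq' hr h
  rw [e]

/-- Translation by `g⁻¹` is a two-sided inverse, so its derivative inverts this one. -/
lemma mfderiv_leftMulTo_bijective (hp : 𝒢.source g = p) (hq : 𝒢.target g = q) (h : 𝒢.tFiber p) :
    Bijective (mfderiv 𝓘(ℝ, 𝒢.tModel) 𝓘(ℝ, 𝒢.tModel) (𝒢.leftMulTo g hp hq) h) := by
  refine ⟨LeftInverse.injective (mfderiv_leftMulTo_inv_apply hp hq h), fun v ↦ ?_⟩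
  refine ⟨mfderiv 𝓘(ℝ, 𝒢.tModel) 𝓘(ℝ, 𝒢.tModel)
      (𝒢.leftMulTo (𝒢.inv g) ((𝒢.source_inv g).trans hq) ((𝒢.target_inv g).trans hp))
      (𝒢.leftMulTo g hp hq h) v, ?_⟩
  refine (mfderiv_comp_apply_of_eq _ (mdifferentiableAt_leftMulTo hp hq h)
    (mdifferentiableAt_leftMulTo _ _ _) (leftMulTo_inv_leftMulTo hp hq h) v).symm.trans ?_
  have e : 𝒢.leftMulTo g hp hq ∘ 𝒢.leftMulTo (𝒢.inv g) ((𝒢.source_inv g).trans hq)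
      ((𝒢.target_inv g).trans hp) = id := funext fun h ↦ leftMulTo_leftMulTo_inv hp hq h
  rw [e]
  exact DFunLike.congr_fun (mfderiv_id (I := 𝓘(ℝ, 𝒢.tModel)) (x := 𝒢.leftMulTo g hp hq h)) v

variable (𝒢) in
/-- The value at `p` of a section of `AG`, as a tangent vector of `t⁻¹(p)` at `1_p`. -/
def unitVector (X : Π p, 𝒢.algebroidFiber p) (p : M) :
    TangentSpace 𝓘(ℝ, 𝒢.tModel) (𝒢.unitPoint p) :=
  (SubmersionFiber.tangentEquiv (𝒢.unitPoint p)).symm (X p)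

lemma inclDeriv_unitVector (X : Π p, 𝒢.algebroidFiber p) (p : M) :
    SubmersionFiber.inclDeriv (𝒢.unitPoint p) (𝒢.unitVector X p) = X p :=
  (SubmersionFiber.tangentEquiv (𝒢.unitPoint p)).apply_symm_apply (X p)

variable (𝒢) in
/-- The restriction to the fibre `t⁻¹(q)` of the left-invariant vector field associated to a section
of `AG`. -/
def fiberField (X : Π p, 𝒢.algebroidFiber p) (q : M) (x : 𝒢.tFiber q) :
    TangentSpace 𝓘(ℝ, 𝒢.tModel) x :=
  mfderiv 𝓘(ℝ, 𝒢.tModel) 𝓘(ℝ, 𝒢.tModel) (𝒢.leftMulTo x.incl rfl x.map_incl)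
    (𝒢.unitPoint (𝒢.source x.incl)) (𝒢.unitVector X (𝒢.source x.incl))

lemma fiberField_eq (X : Π p, 𝒢.algebroidFiber p) (hp : 𝒢.source g = p) (hq : 𝒢.target g = q) :
    𝒢.fiberField X q ⟨g, hq⟩ = mfderiv 𝓘(ℝ, 𝒢.tModel) 𝓘(ℝ, 𝒢.tModel) (𝒢.leftMulTo g hp hq)
      (𝒢.unitPoint p) (𝒢.unitVector X p) := by
  subst hp
  rfl

lemma mfderiv_leftMulTo_unit_apply (p : M) (v : TangentSpace 𝓘(ℝ, 𝒢.tModel) (𝒢.unitPoint p)) :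
    mfderiv 𝓘(ℝ, 𝒢.tModel) 𝓘(ℝ, 𝒢.tModel)
      (𝒢.leftMulTo (𝒢.unit p) (𝒢.source_unit p) (𝒢.target_unit p)) (𝒢.unitPoint p) v = v := by
  have e : 𝒢.leftMulTo (𝒢.unit p) (𝒢.source_unit p) (𝒢.target_unit p) = id := by
    funext h
    apply SubmersionFiber.incl_injective
    have h1 := 𝒢.unit_mul h.incl
    rw [h.map_incl] at h1
    exact h1
  rw [e]
  exact DFunLike.congr_fun (mfderiv_id (I := 𝓘(ℝ, 𝒢.tModel)) (x := 𝒢.unitPoint p)) _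

/-- Left multiplication preserves the vector fields `fiberField X`. -/
lemma mfderiv_leftMulTo_fiberField (X : Π p, 𝒢.algebroidFiber p) (hp : 𝒢.source g = p)
    (hq : 𝒢.target g = q) (h : 𝒢.tFiber p) :
    mfderiv 𝓘(ℝ, 𝒢.tModel) 𝓘(ℝ, 𝒢.tModel) (𝒢.leftMulTo g hp hq) h (𝒢.fiberField X p h) =
      𝒢.fiberField X q (𝒢.leftMulTo g hp hq h) := by
  -- The field at `h` is itself a translate by `h` of a vector at a unit, and `l_g l_h = l_{gh}`.
  refine (mfderiv_leftMulTo_comp_apply rfl h.map_incl hp hq (leftMulTo_incl_unitPoint h) _).trans ?_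
  exact (fiberField_eq X _ _).symm

/-- The intrinsic field on the fibre and the ambient left-invariant field on `G` are related by the
inclusion. This transfers smoothness and brackets between them. -/
lemma mfderiv_incl_fiberField (X : Π p, 𝒢.algebroidFiber p) (x : 𝒢.tFiber q) :
    mfderiv 𝓘(ℝ, 𝒢.tModel) I SubmersionFiber.incl x (𝒢.fiberField X q x) =
      𝒢.leftInvariantField X x.incl := by
  exact (mfderiv_comp_apply_of_eq _ (SubmersionFiber.mdifferentiableAt_incl x)
    (mdifferentiableAt_leftMulTo _ _ _) (leftMulTo_incl_unitPoint x) _).symm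

lemma contMDiff_fiberField (X : 𝒢.AlgebroidSection) (q : M) :
    ContMDiff 𝓘(ℝ, 𝒢.tModel) 𝓘(ℝ, 𝒢.tModel).tangent ∞ (fun x ↦
      (⟨x, 𝒢.fiberField X q x⟩ : TangentBundle 𝓘(ℝ, 𝒢.tModel) (𝒢.tFiber q))) := by
  intro x
  refine SubmersionFiber.contMDiffAt_tangent_of_incl ?_
  simp only [mfderiv_incl_fiberField]
  exact ((𝒢.contMDiff_leftInvariantField X).comp SubmersionFiber.contMDiff_incl).contMDiffAt

/-- The bracket of `AG` computes the brackets of the left-invariant vector fields on the fibres. -/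
lemma mlieBracket_fiberField [FiniteDimensional ℝ E] [IsManifold J ∞ M] (X Y : 𝒢.AlgebroidSection)
    (q : M) (x : 𝒢.tFiber q) :
    VectorField.mlieBracket 𝓘(ℝ, 𝒢.tModel) (𝒢.fiberField X q) (𝒢.fiberField Y q) x =
      𝒢.fiberField (𝒢.bracket X Y) q x := by
  have : Nonempty G := ⟨x.incl⟩
  have := FiniteDimensional.complete ℝ E
  have := FiniteDimensional.complete ℝ 𝒢.tModel
  have hd : ∀ (Z : 𝒢.AlgebroidSection) (r : M) (y : 𝒢.tFiber r),
      MDifferentiableAt 𝓘(ℝ, 𝒢.tModel) 𝓘(ℝ, 𝒢.tModel).tangent (fun x ↦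
        (⟨x, 𝒢.fiberField Z r x⟩ : TangentBundle 𝓘(ℝ, 𝒢.tModel) (𝒢.tFiber r))) y :=
    fun Z r y ↦ (contMDiff_fiberField Z r).mdifferentiableAt (by simp)
  set p := 𝒢.source x.incl with hp
  -- At the unit, relatedness by the inclusion into `G` identifies the fibre bracket with the
  -- bracket of `AG`, which is defined by the ambient fields.
  have h1 := mfderiv_mlieBracket_of_related (SubmersionFiber.contMDiff_incl)
    (hd X p (𝒢.unitPoint p)) (hd Y p (𝒢.unitPoint p))
    ((𝒢.contMDiff_leftInvariantField X).mdifferentiableAt (by simp))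
    ((𝒢.contMDiff_leftInvariantField Y).mdifferentiableAt (by simp))
    (mfderiv_incl_fiberField X) (mfderiv_incl_fiberField Y)
  have h2 : VectorField.mlieBracket 𝓘(ℝ, 𝒢.tModel) (𝒢.fiberField X p) (𝒢.fiberField Y p)
      (𝒢.unitPoint p) = 𝒢.unitVector (𝒢.bracket X Y) p := by
    apply SubmersionFiber.inclDeriv_injective
    rw [inclDeriv_unitVector]
    exact Subtype.ext h1
  -- Each field is related to itself by left translation, so the bracket at `x` is the translate of
  -- the bracket at the unit.
  have h3 := mfderiv_mlieBracket_of_related (contMDiff_leftMulTo hp.symm x.map_incl)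
    (hd X p (𝒢.unitPoint p)) (hd Y p (𝒢.unitPoint p)) (hd X q _) (hd Y q _)
    (mfderiv_leftMulTo_fiberField X hp.symm x.map_incl)
    (mfderiv_leftMulTo_fiberField Y hp.symm x.map_incl)
  rw [h2] at h3
  have h4 := h3.symm
  rw [leftMulTo_unitPoint] at h4
  exact h4.trans (fiberField_eq _ hp.symm x.map_incl).symm

end LieGroupoid

/-! ### Left-invariant forms: restriction to the units and extension from them. -/

namespace LieGroupoid

variable {E : Type u} [NormedAddCommGroup E] [NormedSpace ℝ E]
  {H : Type*} [TopologicalSpace H] {I : ModelWithCorners ℝ E H}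
  {E' : Type*} [NormedAddCommGroup E'] [NormedSpace ℝ E']
  {H' : Type*} [TopologicalSpace H'] {J : ModelWithCorners ℝ E' H'}
  {G : Type*} [TopologicalSpace G] [ChartedSpace H G]
  {M : Type*} [TopologicalSpace M] [ChartedSpace H' M]
  {𝒢 : LieGroupoid I J G M} [IsManifold I ∞ G] [I.Boundaryless] {g : G} {p q : M} {k : ℕ}

lemma IsLeftInvariant.restrictFiber_leftMulTo {α : Π g, 𝒢.tTangent g [⋀^Fin k]→L[ℝ] ℝ}
    (hα : 𝒢.IsLeftInvariant α) (hp : 𝒢.source g = p) (hq : 𝒢.target g = q) (h : 𝒢.tFiber p)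
    (v : Fin k → TangentSpace 𝓘(ℝ, 𝒢.tModel) h) :
    𝒢.restrictFiber α q (𝒢.leftMulTo g hp hq h)
      (fun i ↦ mfderiv 𝓘(ℝ, 𝒢.tModel) 𝓘(ℝ, 𝒢.tModel) (𝒢.leftMulTo g hp hq) h (v i)) =
    𝒢.restrictFiber α p h v := by
  subst hp hq
  exact DFunLike.congr_fun (hα g h) v

/-- Invariance under `l_g` read at the unit, which `l_g` sends to `g`. As every tangent vector at
`g` is such a translate, this describes the whole form at `g`. -/
lemma IsLeftInvariant.restrictFiber_eq {α : Π g, 𝒢.tTangent g [⋀^Fin k]→L[ℝ] ℝ}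
    (hα : 𝒢.IsLeftInvariant α) (hp : 𝒢.source g = p) (hq : 𝒢.target g = q)
    (v : Fin k → TangentSpace 𝓘(ℝ, 𝒢.tModel) (𝒢.unitPoint p)) :
    𝒢.restrictFiber α q ⟨g, hq⟩ (fun i ↦ (mfderiv 𝓘(ℝ, 𝒢.tModel) 𝓘(ℝ, 𝒢.tModel)
      (𝒢.leftMulTo g hp hq) (𝒢.unitPoint p) (v i) : 𝒢.tModel)) =
    α (𝒢.unit p) (fun i ↦ SubmersionFiber.inclDeriv (𝒢.unitPoint p) (v i)) := by
  have h := hα.restrictFiber_leftMulTo hp hq (𝒢.unitPoint p) v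
  rw [leftMulTo_unitPoint] at h
  exact h

/-- A left-invariant form takes left-invariant vector fields to functions that are constant along
left translations. -/
lemma IsLeftInvariant.restrictFiber_fiberField {α : Π g, 𝒢.tTangent g [⋀^Fin k]→L[ℝ] ℝ}
    (hα : 𝒢.IsLeftInvariant α) (X : Fin k → Π p, 𝒢.algebroidFiber p) (x : 𝒢.tFiber q) :
    𝒢.restrictFiber α q x (fun i ↦ 𝒢.fiberField (X i) q x) =
      α (𝒢.unit (𝒢.source x.incl)) (fun i ↦ X i (𝒢.source x.incl)) := by
  refine (hα.restrictFiber_eq rfl x.map_incl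
    (fun i ↦ 𝒢.unitVector (X i) (𝒢.source x.incl))).trans ?_
  simp only [inclDeriv_unitVector]

/-- Every tangent vector of `t⁻¹(q)` is a left translate of a tangent vector at a unit. -/
lemma exists_mfderiv_leftMulTo_eq (x : 𝒢.tFiber q) (v : TangentSpace 𝓘(ℝ, 𝒢.tModel) x) :
    ∃ a : TangentSpace 𝓘(ℝ, 𝒢.tModel) (𝒢.unitPoint (𝒢.source x.incl)),
      (mfderiv 𝓘(ℝ, 𝒢.tModel) 𝓘(ℝ, 𝒢.tModel) (𝒢.leftMulTo x.incl rfl x.map_incl)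
        (𝒢.unitPoint (𝒢.source x.incl)) a : 𝒢.tModel) = v :=
  (mfderiv_leftMulTo_bijective rfl x.map_incl (𝒢.unitPoint (𝒢.source x.incl))).2 v

/-- A left-invariant form is determined by its values at the units. -/
lemma IsLeftInvariant.ext {α β : Π g, 𝒢.tTangent g [⋀^Fin k]→L[ℝ] ℝ} (hα : 𝒢.IsLeftInvariant α)
    (hβ : 𝒢.IsLeftInvariant β) (h : ∀ p, α (𝒢.unit p) = β (𝒢.unit p)) : α = β := by
  funext g
  ext v
  let x : 𝒢.tFiber (𝒢.target g) := ⟨g, rfl⟩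
  -- Each vertical vector is written as a tangent vector of the fibre, and then as a left translate
  -- from the unit, where the two forms agree.
  choose w hw using fun i ↦ SubmersionFiber.inclDeriv_surjective x (v i)
  choose a ha using fun i ↦ exists_mfderiv_leftMulTo_eq x (w i)
  have h1 := hα.restrictFiber_eq rfl rfl a
  have h2 := hβ.restrictFiber_eq rfl rfl a
  rw [h, ← h2] at h1
  have e : (fun i ↦ (mfderiv 𝓘(ℝ, 𝒢.tModel) 𝓘(ℝ, 𝒢.tModel) (𝒢.leftMulTo g rfl rfl)
      (𝒢.unitPoint (𝒢.source g)) (a i) : 𝒢.tModel)) = w := funext ha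
  rw [e] at h1
  have e' : v = fun i ↦ SubmersionFiber.inclDeriv x (w i) := funext fun i ↦ (hw i).symm
  rw [e']
  exact h1

/-- The restriction of a smooth section of `∧ᵏ(TᵗG)*` to a fibre of `t` is smooth. -/
lemma isSmoothForm_restrictFiber [FiniteDimensional ℝ E] (α : 𝒢.leftInvariantForms k) (p : M) :
    IsSmoothForm 𝓘(ℝ, 𝒢.tModel) (𝒢.restrictFiber α.1 p) := by
  intro U hU X hX x hx
  refine ContMDiffAt.contMDiffWithinAt ?_
  -- The form is given along the identity of `G`; tangent vectors of the fibre are a family of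
  -- vertical vectors along the inclusion.
  refine contMDiffAt_verticalForm_apply (K' := I) 𝒢.isSubmersion_target contMDiff_id α.2.1
    (b := SubmersionFiber.incl) (v := fun i y ↦ SubmersionFiber.inclDeriv y (X i y))
    SubmersionFiber.contMDiff_incl.contMDiffAt fun i ↦ ?_
  exact ContMDiffAt.mfderiv_comp_apply SubmersionFiber.contMDiff_incl.contMDiffAt
    ((hX i).contMDiffAt (hU.mem_nhds hx))

/-- A local section of `AG` is a smooth family of vertical vectors along the unit map. It need not
come with an extension to a vertical field on `G`, so the criterion for families is what applies. -/
lemma unit_mem_algebroidForms [FiniteDimensional ℝ E] [IsManifold J ∞ M]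
    (α : 𝒢.leftInvariantForms k) : (fun p ↦ α.1 (𝒢.unit p)) ∈ 𝒢.algebroidForms k := by
  intro U hU X hX p hp
  refine ContMDiffAt.contMDiffWithinAt ?_
  exact contMDiffAt_verticalForm_apply (K' := I) 𝒢.isSubmersion_target contMDiff_id α.2.1
    (b := 𝒢.unit) (v := X) 𝒢.contMDiff_unit.contMDiffAt
    fun i ↦ (hX i).contMDiffAt (hU.mem_nhds hp)

variable (𝒢 k) in
/-- Restriction of left-invariant forms to the units. -/
def restrictUnits [FiniteDimensional ℝ E] [IsManifold J ∞ M] :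
    𝒢.leftInvariantForms k →ₗ[ℝ] 𝒢.algebroidForms k where
  toFun α := ⟨fun p ↦ α.1 (𝒢.unit p), unit_mem_algebroidForms α⟩
  map_add' _ _ := rfl
  map_smul' _ _ := rfl

lemma restrictUnits_injective [FiniteDimensional ℝ E] [IsManifold J ∞ M] :
    Injective (𝒢.restrictUnits k) := fun α β h ↦
  Subtype.ext (α.2.2.ext β.2.2 fun p ↦ congrFun (congrArg Subtype.val h) p)

variable (𝒢) in
/-- Left translation `(TᵗG)_g → (AG)_{s(g)}` by `g⁻¹`. -/
def translateToUnit [FiniteDimensional ℝ E] (g : G) :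
    𝒢.tTangent g →L[ℝ] 𝒢.algebroidFiber (𝒢.source g) :=
  have : FiniteDimensional ℝ (TangentSpace I g) := inferInstanceAs (FiniteDimensional ℝ E)
  have : T2Space (TangentSpace I g) := inferInstanceAs (T2Space E)
  let D : TangentSpace 𝓘(ℝ, 𝒢.tModel) (⟨g, rfl⟩ : 𝒢.tFiber (𝒢.target g)) →L[ℝ]
      TangentSpace 𝓘(ℝ, 𝒢.tModel) (𝒢.unitPoint (𝒢.source g)) :=
    mfderiv 𝓘(ℝ, 𝒢.tModel) 𝓘(ℝ, 𝒢.tModel)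
      (𝒢.leftMulTo (𝒢.inv g) (𝒢.source_inv g) (𝒢.target_inv g)) ⟨g, rfl⟩
  -- `tangentEquiv` is only a linear equivalence; continuity comes from finite dimension.
  LinearMap.toContinuousLinearMap
    ((SubmersionFiber.inclDeriv (𝒢.unitPoint (𝒢.source g))).toLinearMap ∘ₗ D.toLinearMap ∘ₗ (SubmersionFiber.tangentEquiv ⟨g, rfl⟩).symm.toLinearMap)

lemma translateToUnit_inclDeriv [FiniteDimensional ℝ E] (g : G)
    (w : TangentSpace 𝓘(ℝ, 𝒢.tModel) (⟨g, rfl⟩ : 𝒢.tFiber (𝒢.target g))) :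
    𝒢.translateToUnit g (SubmersionFiber.inclDeriv ⟨g, rfl⟩ w) =
      SubmersionFiber.inclDeriv (𝒢.unitPoint (𝒢.source g))
        (mfderiv 𝓘(ℝ, 𝒢.tModel) 𝓘(ℝ, 𝒢.tModel)
          (𝒢.leftMulTo (𝒢.inv g) (𝒢.source_inv g) (𝒢.target_inv g)) ⟨g, rfl⟩ w : 𝒢.tModel) := by
  have h := (SubmersionFiber.tangentEquiv (⟨g, rfl⟩ : 𝒢.tFiber (𝒢.target g))).symm_apply_apply w
  exact congrArg (fun w ↦ SubmersionFiber.inclDeriv (𝒢.unitPoint (𝒢.source g))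
        (mfderiv 𝓘(ℝ, 𝒢.tModel) 𝓘(ℝ, 𝒢.tModel)
          (𝒢.leftMulTo (𝒢.inv g) (𝒢.source_inv g) (𝒢.target_inv g)) ⟨g, rfl⟩ w : 𝒢.tModel)) h

variable (𝒢) in
/-- The left-invariant extension of a family of forms on the fibres of `AG`. -/
def extendForm [FiniteDimensional ℝ E] (β : Π p, 𝒢.algebroidFiber p [⋀^Fin k]→L[ℝ] ℝ) (g : G) :
    𝒢.tTangent g [⋀^Fin k]→L[ℝ] ℝ :=
  (β (𝒢.source g)).compContinuousLinearMap (𝒢.translateToUnit g)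

/-- Translation by `g⁻¹` in the definition of the extension cancels translation by `g`. Invariance
of the extension and its values at the units both follow from this formula. -/
lemma restrictFiber_extendForm [FiniteDimensional ℝ E]
    (β : Π p, 𝒢.algebroidFiber p [⋀^Fin k]→L[ℝ] ℝ) (hp : 𝒢.source g = p) (hq : 𝒢.target g = q)
    (v : Fin k → TangentSpace 𝓘(ℝ, 𝒢.tModel) (𝒢.unitPoint p)) :
    𝒢.restrictFiber (𝒢.extendForm β) q ⟨g, hq⟩ (fun i ↦ (mfderiv 𝓘(ℝ, 𝒢.tModel) 𝓘(ℝ, 𝒢.tModel)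
      (𝒢.leftMulTo g hp hq) (𝒢.unitPoint p) (v i) : 𝒢.tModel)) =
    β p (fun i ↦ SubmersionFiber.inclDeriv (𝒢.unitPoint p) (v i)) := by
  subst hp hq
  refine congrArg (β (𝒢.source g)) (funext fun i ↦ ?_)
  refine (translateToUnit_inclDeriv g _).trans ?_
  have h := mfderiv_leftMulTo_inv_apply rfl rfl (𝒢.unitPoint (𝒢.source g)) (v i)
  rw [leftMulTo_unitPoint] at h
  exact congrArg _ h

/-- Vectors at `h` are translates of vectors `a i` at the unit of `s(h)`, and their images under
`l_g` are the translates of the same `a i` by `gh`. Both sides therefore equal `β` on the `a i`,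
because `s(gh) = s(h)`. -/
lemma isLeftInvariant_extendForm [FiniteDimensional ℝ E]
    (β : Π p, 𝒢.algebroidFiber p [⋀^Fin k]→L[ℝ] ℝ) : 𝒢.IsLeftInvariant (𝒢.extendForm β) := by
  intro g h
  ext v
  choose a ha using fun i ↦ exists_mfderiv_leftMulTo_eq h (v i)
  have h1 := restrictFiber_extendForm β rfl h.map_incl a
  have h2 := restrictFiber_extendForm β
    (𝒢.source_mul g h.incl h.map_incl.symm) (𝒢.target_mul g h.incl h.map_incl.symm) a
  have e : (fun i ↦ (mfderiv 𝓘(ℝ, 𝒢.tModel) 𝓘(ℝ, 𝒢.tModel)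
      (𝒢.leftMulTo h.incl rfl h.map_incl) (𝒢.unitPoint _) (a i) : 𝒢.tModel)) = v := funext ha
  rw [e] at h1
  refine Eq.trans ?_ (h2.trans h1.symm)
  refine congrArg (𝒢.restrictFiber (𝒢.extendForm β) (𝒢.target g) (𝒢.leftMul g h))
    (funext fun i ↦ ?_)
  refine Eq.trans ?_ (mfderiv_leftMulTo_comp_apply rfl h.map_incl rfl rfl
    (leftMulTo_incl_unitPoint h) (a i))
  exact congrArg (mfderiv 𝓘(ℝ, 𝒢.tModel) 𝓘(ℝ, 𝒢.tModel) (𝒢.leftMul g) h) (ha i).symm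

lemma extendForm_unit [FiniteDimensional ℝ E]
    (β : Π p, 𝒢.algebroidFiber p [⋀^Fin k]→L[ℝ] ℝ) (p : M) :
    𝒢.extendForm β (𝒢.unit p) = β p := by
  ext v
  choose a ha using fun i ↦ SubmersionFiber.inclDeriv_surjective (𝒢.unitPoint p) (v i)
  have h := restrictFiber_extendForm β (𝒢.source_unit p) (𝒢.target_unit p) a
  have e : (fun i ↦ (mfderiv 𝓘(ℝ, 𝒢.tModel) 𝓘(ℝ, 𝒢.tModel)
      (𝒢.leftMulTo (𝒢.unit p) (𝒢.source_unit p) (𝒢.target_unit p)) (𝒢.unitPoint p) (a i) :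
      𝒢.tModel)) = a := funext fun i ↦ mfderiv_leftMulTo_unit_apply p (a i)
  rw [e] at h
  have e' : v = fun i ↦ SubmersionFiber.inclDeriv (𝒢.unitPoint p) (a i) :=
    funext fun i ↦ (ha i).symm
  rw [e']
  exact h

/-- The domain of `l_{g⁻¹}` is a fibre that varies with `g`, and multiplication is smooth only on
composable pairs. A submersion chart of `t` removes the obstacle: `K g v = g⁻¹ · point (t(g)) v`
always multiplies composable arrows and is smooth in `(g, v)` on an open set. The translated vector
is the derivative of `K g` applied to the fibre coordinates of `U g`, hence smooth in `g`. -/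
lemma contMDiffAt_translateToUnit [FiniteDimensional ℝ E] {U : Π g, 𝒢.tTangent g} {g₀ : G}
    (hU : ContMDiffAt I I.tangent ∞ (fun g ↦ (⟨g, U g⟩ : TangentBundle I G)) g₀) :
    ContMDiffAt I I.tangent ∞ (fun g ↦
      (⟨𝒢.unit (𝒢.source g), 𝒢.translateToUnit g (U g)⟩ : TangentBundle I G)) g₀ := by
  set hf := 𝒢.isSubmersion_target
  have hg₀ : g₀ ∈ (SubmersionFiber.normalForm hf g₀).domChart.source :=
    (SubmersionFiber.normalForm hf g₀).mem_domChart_source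
  set K : G → hf.complement → G :=
    fun g v ↦ 𝒢.mul (𝒢.inv g) (SubmersionFiber.point hf g₀ (𝒢.target g) v) with hK
  have hKs : ∀ g ∈ (SubmersionFiber.normalForm hf g₀).domChart.source,
      ContMDiffAt (I.prod 𝓘(ℝ, hf.complement)) I ∞ (uncurry K)
        (g, SubmersionFiber.coord hf g₀ g) := by
    intro g hg
    have h0 : ContMDiff (I.prod 𝓘(ℝ, hf.complement)) (J.prod 𝓘(ℝ, hf.complement)) ∞
        (fun q : G × hf.complement ↦ (𝒢.target q.1, q.2)) :=
      (𝒢.contMDiff_target.comp contMDiff_fst).prodMk contMDiff_snd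
    set O : Set (G × hf.complement) := (fun q : G × hf.complement ↦ (𝒢.target q.1, q.2)) ⁻¹'
      SubmersionFiber.pointDomain hf g₀
    have hOo : IsOpen O := (SubmersionFiber.isOpen_pointDomain g₀).preimage h0.continuous
    have h1 : ContMDiffOn (I.prod 𝓘(ℝ, hf.complement)) I ∞ (fun q : G × hf.complement ↦
        SubmersionFiber.point hf g₀ (𝒢.target q.1) q.2) O :=
      ContMDiffOn.comp (g := fun p : M × hf.complement ↦ SubmersionFiber.point hf g₀ p.1 p.2)
        (SubmersionFiber.contMDiffOn_point g₀) h0.contMDiffOn (mapsTo_preimage _ _)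
    have h2 : ContMDiffOn (I.prod 𝓘(ℝ, hf.complement)) (I.prod I) ∞ (fun q : G × hf.complement ↦
        (𝒢.inv q.1, SubmersionFiber.point hf g₀ (𝒢.target q.1) q.2)) O :=
      (𝒢.contMDiff_inv.comp contMDiff_fst).contMDiffOn.prodMk h1
    have h3 : ContMDiffOn (I.prod 𝓘(ℝ, hf.complement)) I ∞ (uncurry K) O := by
      refine 𝒢.contMDiffOn_mul.comp h2 fun q hq ↦ ?_
      exact (𝒢.source_inv q.1).trans
        (SubmersionFiber.map_point (p := (𝒢.target q.1, q.2)) hq).symm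
    exact h3.contMDiffAt (hOo.mem_nhds (SubmersionFiber.mem_pointDomain hg))
  have hw := ContMDiffAt.mfderiv_comp_apply (J := 𝓘(ℝ, hf.complement))
    (f := SubmersionFiber.coord hf g₀) (g := fun g ↦ g)
    (SubmersionFiber.contMDiffAt_coord hg₀) hU
  have hk := ContMDiffAt.mfderiv_family_apply (f := K) (g := SubmersionFiber.coord hf g₀)
    (hKs g₀ hg₀) hw
  refine hk.congr_of_eventuallyEq ?_
  filter_upwards [SubmersionFiber.source_mem_nhds hg₀] with g hg
  have hKg : K g (SubmersionFiber.coord hf g₀ g) = 𝒢.unit (𝒢.source g) := by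
    rw [hK]
    simp only [SubmersionFiber.point_coord hg, 𝒢.inv_mul]
  refine tangentBundle_mk_congr hKg.symm ?_
  let x : 𝒢.tFiber (𝒢.target g) := ⟨g, rfl⟩
  obtain ⟨w, hw⟩ := SubmersionFiber.inclDeriv_surjective x (U g)
  have hw' : mfderiv 𝓘(ℝ, 𝒢.tModel) I SubmersionFiber.incl x w = (U g : TangentSpace I g) :=
    congrArg Subtype.val hw
  have hx : 𝒢.leftMulTo (𝒢.inv g) (𝒢.source_inv g) (𝒢.target_inv g) x =
      𝒢.unitPoint (𝒢.source g) := SubmersionFiber.incl_injective (𝒢.inv_mul g)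
  have t1 : (𝒢.translateToUnit g (U g) : TangentSpace I (𝒢.unit (𝒢.source g))) =
      mfderiv 𝓘(ℝ, 𝒢.tModel) I SubmersionFiber.incl (𝒢.unitPoint (𝒢.source g))
        (mfderiv 𝓘(ℝ, 𝒢.tModel) 𝓘(ℝ, 𝒢.tModel)
          (𝒢.leftMulTo (𝒢.inv g) (𝒢.source_inv g) (𝒢.target_inv g)) x w : 𝒢.tModel) := by
    rw [← hw]
    exact congrArg Subtype.val (translateToUnit_inclDeriv g w)
  have t2 := mfderiv_comp_apply_of_eq x
    (SubmersionFiber.mdifferentiableAt_incl (𝒢.unitPoint (𝒢.source g)))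
    (mdifferentiableAt_leftMulTo (𝒢.source_inv g) (𝒢.target_inv g) x) hx w
  have hcd : MDifferentiableAt I 𝓘(ℝ, hf.complement) (SubmersionFiber.coord hf g₀) g :=
    (SubmersionFiber.contMDiffAt_coord hg).mdifferentiableAt (by simp)
  have hin := SubmersionFiber.mdifferentiableAt_incl x
  have hKd : MDifferentiableAt 𝓘(ℝ, hf.complement) I (K g) (SubmersionFiber.coord hf g₀ g) :=
    (ContMDiffAt.comp (g := uncurry K) (f := fun v ↦ (g, v)) _ (hKs g hg)
      (contMDiffAt_const.prodMk contMDiffAt_id)).mdifferentiableAt (by simp)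
  have e : SubmersionFiber.incl ∘ 𝒢.leftMulTo (𝒢.inv g) (𝒢.source_inv g) (𝒢.target_inv g)
      =ᶠ[𝓝 x] K g ∘ (SubmersionFiber.coord hf g₀ ∘ SubmersionFiber.incl) := by
    filter_upwards [SubmersionFiber.isInducing_incl.continuous.continuousAt.preimage_mem_nhds
      (SubmersionFiber.source_mem_nhds hg)] with z hz
    exact congrArg (𝒢.mul (𝒢.inv g)) (SubmersionFiber.point_coord_incl hz).symm
  have d1 := mfderiv_comp_apply x hcd hin w
  have d2 := mfderiv_comp_apply x hKd (hcd.comp x hin) w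
  have d3 := DFunLike.congr_fun (e.mfderiv_eq (I := 𝓘(ℝ, 𝒢.tModel)) (I' := I)) w
  refine (t1.trans (t2.symm.trans (d3.trans d2))).trans ?_
  exact congrArg (mfderiv 𝓘(ℝ, hf.complement) I (K g) (SubmersionFiber.coord hf g₀ g))
    (d1.trans (congrArg (mfderiv I 𝓘(ℝ, hf.complement) (SubmersionFiber.coord hf g₀) g) hw'))

/-- On vertical fields the extension is `β` at `s(g)` applied to the translated vectors, a smooth
family along `unit ∘ source`. -/
lemma extendForm_mem [FiniteDimensional ℝ E] [IsManifold J ∞ M] (β : 𝒢.algebroidForms k) :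
    𝒢.extendForm β.1 ∈ 𝒢.leftInvariantForms k := by
  refine ⟨fun U hU X hX g hg ↦ ContMDiffAt.contMDiffWithinAt ?_, isLeftInvariant_extendForm β.1⟩
  exact contMDiffAt_verticalForm_apply (K' := J) 𝒢.isSubmersion_target 𝒢.contMDiff_unit β.2
    (b := 𝒢.source) (v := fun i g ↦ 𝒢.translateToUnit g (X i g)) 𝒢.contMDiff_source.contMDiffAt
    fun i ↦ contMDiffAt_translateToUnit ((hX i).contMDiffAt (hU.mem_nhds hg))

lemma restrictUnits_surjective [FiniteDimensional ℝ E] [IsManifold J ∞ M] :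
    Surjective (𝒢.restrictUnits k) := fun β ↦
  ⟨⟨𝒢.extendForm β.1, extendForm_mem β⟩, Subtype.ext (funext fun p ↦ extendForm_unit β.1 p)⟩

end LieGroupoid

/-! ### Comparison of closedness and nondegeneracy on the fibres and on the algebroid. -/

namespace LieGroupoid

variable {E : Type u} [NormedAddCommGroup E] [NormedSpace ℝ E]
  {H : Type*} [TopologicalSpace H] {I : ModelWithCorners ℝ E H}
  {E' : Type*} [NormedAddCommGroup E'] [NormedSpace ℝ E']
  {H' : Type*} [TopologicalSpace H'] {J : ModelWithCorners ℝ E' H'}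
  {G : Type*} [TopologicalSpace G] [ChartedSpace H G]
  {M : Type*} [TopologicalSpace M] [ChartedSpace H' M]
  {𝒢 : LieGroupoid I J G M} [IsManifold I ∞ G] [I.Boundaryless] {g : G} {p q : M} {k : ℕ}

/-- Every element of `AG` is the value of a section. -/
lemma exists_algebroidSection_eq [FiniteDimensional ℝ E'] [IsManifold J ∞ M] [T2Space M]
    (p : M) (v : 𝒢.algebroidFiber p) : ∃ X : 𝒢.AlgebroidSection, X p = v := by
  classical
  set hf := 𝒢.isSubmersion_target
  set S := (SubmersionFiber.normalForm hf (𝒢.unit p)).domChart.source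
  have hpS : 𝒢.unit p ∈ S := (SubmersionFiber.normalForm hf (𝒢.unit p)).mem_domChart_source
  set w : hf.complement :=
    mfderiv I 𝓘(ℝ, hf.complement) (SubmersionFiber.coord hf (𝒢.unit p)) (𝒢.unit p) v
  have hnhds : 𝒢.unit ⁻¹' S ∈ 𝓝 p :=
    𝒢.contMDiff_unit.continuous.continuousAt.preimage_mem_nhds
      (SubmersionFiber.source_mem_nhds hpS)
  obtain ⟨ψ, -, hψ⟩ := (SmoothBumpFunction.nhds_basis_tsupport (I := J) p).mem_iff.1 hnhds
  -- The vertical field with the constant fibre coordinate `w` of `v`, cut off by a bump function on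
  -- `M` pulled back along `t`. Since `t` of a unit is its base point, the support condition on `ψ`
  -- controls `Z` at the units, which is all that is used.
  let Z : Π z : G, TangentSpace I z := fun z ↦
    ψ (𝒢.target z) • SubmersionFiber.vertical hf (𝒢.unit p) z w
  have hZ : ∀ q, 𝒢.unit q ∈ S → Z (𝒢.unit q) ∈ 𝒢.tTangent (𝒢.unit q) := fun q hq ↦
    Submodule.smul_mem _ _ (SubmersionFiber.vertical_mem hq w)
  have hψ0 : ∀ q, 𝒢.unit q ∉ S → ψ q = 0 := fun q hq ↦
    image_eq_zero_of_notMem_tsupport fun h ↦ hq (hψ h)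
  have hZ' : ∀ q, Z (𝒢.unit q) ∈ 𝒢.tTangent (𝒢.unit q) := by
    intro q
    by_cases hq : 𝒢.unit q ∈ S
    · exact hZ q hq
    · have : Z (𝒢.unit q) = 0 := by
        simp only [Z, 𝒢.target_unit, hψ0 q hq, zero_smul]
      rw [this]
      exact Submodule.zero_mem _
  have hψs : ContMDiff I 𝓘(ℝ, ℝ) ∞ (fun z ↦ ψ (𝒢.target z)) :=
    ψ.contMDiff.comp 𝒢.contMDiff_target
  refine ⟨⟨fun q ↦ ⟨Z (𝒢.unit q), hZ' q⟩, fun q ↦ ?_⟩, ?_⟩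
  · refine ContMDiffAt.comp (g := fun z ↦ (⟨z, Z z⟩ : TangentBundle I G)) q ?_
      𝒢.contMDiff_unit.contMDiffAt
    -- On the support the unit lies in the submersion chart, where the vertical field is smooth; off
    -- it, `Z` vanishes near the unit.
    by_cases hq : q ∈ tsupport ψ
    · exact hψs.contMDiffAt.smul_section (SubmersionFiber.contMDiffAt_vertical (hψ hq) w)
    · have h0 : ContMDiffAt I I.tangent ∞ (fun z ↦ (⟨z, 0⟩ : TangentBundle I G)) (𝒢.unit q) :=
        (Bundle.contMDiff_zeroSection ℝ (TangentSpace I : G → Type _)).contMDiffAt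
      refine h0.congr_of_eventuallyEq ?_
      have : (𝒢.target ⁻¹' (tsupport ψ)ᶜ) ∈ 𝓝 (𝒢.unit q) := by
        refine 𝒢.contMDiff_target.continuous.continuousAt.preimage_mem_nhds ?_
        rw [𝒢.target_unit]
        exact (isClosed_tsupport _).isOpen_compl.mem_nhds hq
      filter_upwards [this] with z hz
      have hz : ψ (𝒢.target z) = 0 := image_eq_zero_of_notMem_tsupport hz
      simp only [Z, hz, zero_smul]
  · apply Subtype.ext
    change Z (𝒢.unit p) = v
    have h1 : ψ p = 1 := ψ.eq_one
    simp only [Z, 𝒢.target_unit, h1, one_smul]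
    exact SubmersionFiber.vertical_mfderiv_coord hpS v.2

/-- Left translation preserves the source, `s ∘ l_g = s`, so `s_*` of a translated vector is `s_*`
of the original vector at the unit, which is its anchor. -/
lemma mfderiv_source_incl_fiberField [IsManifold J ∞ M] (X : Π p, 𝒢.algebroidFiber p)
    (x : 𝒢.tFiber q) :
    mfderiv 𝓘(ℝ, 𝒢.tModel) J (fun z : 𝒢.tFiber q ↦ 𝒢.source z.incl) x (𝒢.fiberField X q x) =
      𝒢.anchor (𝒢.source x.incl) (X (𝒢.source x.incl)) := by
  set p := 𝒢.source x.incl with hp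
  have hs : ∀ (r : M) (z : 𝒢.tFiber r),
      MDifferentiableAt 𝓘(ℝ, 𝒢.tModel) J (fun z : 𝒢.tFiber r ↦ 𝒢.source z.incl) z := fun r z ↦
    (𝒢.contMDiff_source.comp SubmersionFiber.contMDiff_incl).mdifferentiableAt (by simp)
  have h1 := mfderiv_comp_apply_of_eq (𝒢.unitPoint p) (hs q x)
    (mdifferentiableAt_leftMulTo rfl x.map_incl (𝒢.unitPoint p)) (leftMulTo_incl_unitPoint x)
    (𝒢.unitVector X p)
  have e : (fun z : 𝒢.tFiber q ↦ 𝒢.source z.incl) ∘ 𝒢.leftMulTo x.incl rfl x.map_incl =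
      𝒢.source ∘ SubmersionFiber.incl :=
    funext fun z ↦ 𝒢.source_mul _ _ z.map_incl.symm
  have h2 := mfderiv_comp_apply (𝒢.unitPoint p)
    (𝒢.contMDiff_source.mdifferentiableAt (x := 𝒢.unit p) (by simp))
    (SubmersionFiber.mdifferentiableAt_incl (𝒢.unitPoint p)) (𝒢.unitVector X p)
  rw [e] at h1
  refine h1.symm.trans (h2.trans ?_)
  exact congrArg (mfderiv I J 𝒢.source (𝒢.unit p))
    (congrArg Subtype.val (inclDeriv_unitVector X p))

lemma tangentDeriv_comp_source [IsManifold J ∞ M] (X : 𝒢.AlgebroidSection) {φ : M → ℝ}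
    (hφ : ContMDiff J 𝓘(ℝ, ℝ) ∞ φ) (x : 𝒢.tFiber q) :
    tangentDeriv 𝓘(ℝ, 𝒢.tModel) (fun z : 𝒢.tFiber q ↦ φ (𝒢.source z.incl)) x
      (𝒢.fiberField X q x) = 𝒢.anchorDeriv X φ (𝒢.source x.incl) := by
  have h := mfderiv_comp_apply (f := fun z : 𝒢.tFiber q ↦ 𝒢.source z.incl) x
    (hφ.mdifferentiableAt (x := 𝒢.source x.incl) (by simp))
    ((𝒢.contMDiff_source.comp SubmersionFiber.contMDiff_incl).mdifferentiableAt (by simp))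
    (𝒢.fiberField X q x)
  exact h.trans (congrArg (mfderiv J 𝓘(ℝ, ℝ) φ (𝒢.source x.incl))
    (mfderiv_source_incl_fiberField X x))

/-- The exterior derivative of a left-invariant 2-form along the fibres of `t` is computed by the
Lie algebroid differential of its restriction to the units. -/
lemma mextDeriv_restrictFiber [FiniteDimensional ℝ E] [IsManifold J ∞ M]
    (α : 𝒢.leftInvariantForms 2) (X Y Z : 𝒢.AlgebroidSection) (x : 𝒢.tFiber q) :
    mextDeriv 𝓘(ℝ, 𝒢.tModel) (𝒢.restrictFiber α.1 q) x
      ![𝒢.fiberField X q x, 𝒢.fiberField Y q x, 𝒢.fiberField Z q x] =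
    𝒢.algebroidDeriv (𝒢.restrictUnits 2 α).1 X Y Z (𝒢.source x.incl) := by
  have : Nonempty G := ⟨x.incl⟩
  -- Evaluated on left-invariant fields, the form is a function on `M` pulled back by `s`, so its
  -- derivatives along such fields are anchor derivatives.
  have hval : ∀ (A B : 𝒢.AlgebroidSection) (z : 𝒢.tFiber q),
      𝒢.restrictFiber α.1 q z ![𝒢.fiberField A q z, 𝒢.fiberField B q z] =
        (𝒢.restrictUnits 2 α).1 (𝒢.source z.incl) ![A (𝒢.source z.incl), B (𝒢.source z.incl)] := by
    intro A B z
    have h := α.2.2.restrictFiber_fiberField ![A.toFun, B.toFun] z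
    refine Eq.trans (congrArg _ ?_) (h.trans (congrArg _ ?_))
    · funext i; fin_cases i <;> rfl
    · funext i; fin_cases i <;> rfl
  have hsm : ∀ A B : 𝒢.AlgebroidSection, ContMDiff J 𝓘(ℝ, ℝ) ∞
      (fun r ↦ (𝒢.restrictUnits 2 α).1 r ![A r, B r]) := by
    intro A B
    rw [← contMDiffOn_univ]
    refine ((𝒢.restrictUnits 2 α).2 univ isOpen_univ ![A.toFun, B.toFun] ?_).congr ?_
    · intro i
      fin_cases i
      exacts [A.contMDiff_toFun.contMDiffOn, B.contMDiff_toFun.contMDiffOn]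
    · intro r _
      refine congrArg ((𝒢.restrictUnits 2 α).1 r) ?_
      funext i; fin_cases i <;> rfl
  rw [mextDeriv_apply_vectorField_two (isSmoothForm_restrictFiber α q) (contMDiff_fiberField X q)
    (contMDiff_fiberField Y q) (contMDiff_fiberField Z q)]
  simp only [mlieBracket_fiberField, hval]
  rw [tangentDeriv_comp_source X (hsm Y Z), tangentDeriv_comp_source Y (hsm X Z),
    tangentDeriv_comp_source Z (hsm X Y)]
  rfl

/-- The vector is translated back to the unit and extended to a section of `AG`. This is why the
exterior derivative need only be tested on left-invariant fields. -/
lemma exists_fiberField_eq [FiniteDimensional ℝ E'] [IsManifold J ∞ M] [T2Space M]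
    (x : 𝒢.tFiber q) (v : TangentSpace 𝓘(ℝ, 𝒢.tModel) x) :
    ∃ X : 𝒢.AlgebroidSection, 𝒢.fiberField X q x = v := by
  obtain ⟨a, ha⟩ := exists_mfderiv_leftMulTo_eq x v
  obtain ⟨X, hX⟩ := exists_algebroidSection_eq (𝒢.source x.incl)
    (SubmersionFiber.inclDeriv (𝒢.unitPoint (𝒢.source x.incl)) a)
  refine ⟨X, Eq.trans ?_ ha⟩
  have : 𝒢.unitVector X (𝒢.source x.incl) = a :=
    SubmersionFiber.inclDeriv_injective _ ((inclDeriv_unitVector _ _).trans hX)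
  rw [fiberField, this]

/-- A left-invariant 2-form is closed along the fibres of `t` if and only if its restriction to the
units is closed for the Lie algebroid differential. -/
lemma mextDeriv_restrictFiber_eq_zero_iff [FiniteDimensional ℝ E] [FiniteDimensional ℝ E']
    [IsManifold J ∞ M] [T2Space M] (α : 𝒢.leftInvariantForms 2) :
    (∀ (q : M) (x : 𝒢.tFiber q), mextDeriv 𝓘(ℝ, 𝒢.tModel) (𝒢.restrictFiber α.1 q) x = 0) ↔
      ∀ (X Y Z : 𝒢.AlgebroidSection) (p : M),
        𝒢.algebroidDeriv (𝒢.restrictUnits 2 α).1 X Y Z p = 0 := by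
  constructor
  · intro h X Y Z p
    have h1 := mextDeriv_restrictFiber α X Y Z (𝒢.unitPoint p)
    rw [h p (𝒢.unitPoint p)] at h1
    have h2 : 𝒢.source (𝒢.unitPoint p).incl = p := 𝒢.source_unit p
    rw [h2] at h1
    exact h1.symm
  · intro h q x
    ext v
    -- The exterior derivative at `x` sees only the values of the fields there, so each argument may
    -- be replaced by a left-invariant field through it.
    obtain ⟨X, hX⟩ := exists_fiberField_eq x (v 0)
    obtain ⟨Y, hY⟩ := exists_fiberField_eq x (v 1)
    obtain ⟨Z, hZ⟩ := exists_fiberField_eq x (v 2)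
    have h1 := mextDeriv_restrictFiber α X Y Z x
    rw [h, hX, hY, hZ] at h1
    refine Eq.trans (congrArg _ ?_) h1
    funext i; fin_cases i <;> rfl

/-- A left-invariant 2-form is nondegenerate if and only if its restriction to the units is. -/
lemma restrictFiber_nondegenerate_iff [FiniteDimensional ℝ E] [IsManifold J ∞ M]
    (α : 𝒢.leftInvariantForms 2) :
    (∀ (q : M) (x : 𝒢.tFiber q) (v : TangentSpace 𝓘(ℝ, 𝒢.tModel) x),
      (∀ w, 𝒢.restrictFiber α.1 q x ![v, w] = 0) → v = 0) ↔
    ∀ (p : M) (v : 𝒢.algebroidFiber p), (∀ w, (𝒢.restrictUnits 2 α).1 p ![v, w] = 0) → v = 0 := by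
  constructor
  · intro h p v hv
    obtain ⟨a, rfl⟩ := SubmersionFiber.inclDeriv_surjective (𝒢.unitPoint p) v
    rw [h p (𝒢.unitPoint p) a fun w ↦ ?_]
    · exact map_zero _
    · refine Eq.trans (congrArg (α.1 (𝒢.unit p)) ?_)
        (hv (SubmersionFiber.inclDeriv (𝒢.unitPoint p) w))
      funext i; fin_cases i <;> rfl
  · intro h q x v hv
    obtain ⟨a, ha⟩ := exists_mfderiv_leftMulTo_eq x v
    -- Pairing `a` with `b` at the unit equals pairing `v` with the translate of `b`, which vanishes
    -- by `hv`.
    have h0 : a = 0 := by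
      apply SubmersionFiber.inclDeriv_injective
      rw [map_zero]
      refine h (𝒢.source x.incl) _ fun w ↦ ?_
      obtain ⟨b, rfl⟩ :=
        SubmersionFiber.inclDeriv_surjective (𝒢.unitPoint (𝒢.source x.incl)) w
      have h1 := α.2.2.restrictFiber_eq rfl x.map_incl ![a, b]
      have e : (fun i ↦ (mfderiv 𝓘(ℝ, 𝒢.tModel) 𝓘(ℝ, 𝒢.tModel)
          (𝒢.leftMulTo x.incl rfl x.map_incl) (𝒢.unitPoint (𝒢.source x.incl)) (![a, b] i) :
          𝒢.tModel)) = ![v, (mfderiv 𝓘(ℝ, 𝒢.tModel) 𝓘(ℝ, 𝒢.tModel)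
          (𝒢.leftMulTo x.incl rfl x.map_incl) (𝒢.unitPoint (𝒢.source x.incl)) b :
          𝒢.tModel)] := by
        funext i; fin_cases i
        exacts [ha, rfl]
      have e' : (fun i ↦ SubmersionFiber.inclDeriv (𝒢.unitPoint (𝒢.source x.incl)) (![a, b] i)) =
          ![SubmersionFiber.inclDeriv (𝒢.unitPoint (𝒢.source x.incl)) a,
            SubmersionFiber.inclDeriv (𝒢.unitPoint (𝒢.source x.incl)) b] := by
        funext i; fin_cases i <;> rfl
      rw [e, e'] at h1
      exact h1.symm.trans (hv _)
    exact ha.symm.trans ((congrArg _ h0).trans (map_zero _))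

lemma isTSymplectic_iff_isQuasiFrobenius [FiniteDimensional ℝ E] [FiniteDimensional ℝ E']
    [IsManifold J ∞ M] [T2Space M] (α : 𝒢.leftInvariantForms 2) :
    𝒢.IsTSymplectic α ↔ 𝒢.IsQuasiFrobenius (𝒢.restrictUnits 2 α) :=
  ⟨fun h ↦ ⟨(restrictFiber_nondegenerate_iff α).1 fun q ↦ (h q).nondegenerate,
    (mextDeriv_restrictFiber_eq_zero_iff α).1 fun q ↦ (h q).closed⟩,
  fun h q ↦ ⟨isSmoothForm_restrictFiber α q,
    (mextDeriv_restrictFiber_eq_zero_iff α).2 h.closed q,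
    (restrictFiber_nondegenerate_iff α).2 h.nondegenerate q⟩⟩

end LieGroupoid

end

theorem theorem3p6
    {E : Type*} [NormedAddCommGroup E] [NormedSpace ℝ E] [FiniteDimensional ℝ E]
    {H : Type*} [TopologicalSpace H] (I : ModelWithCorners ℝ E H) [I.Boundaryless]
    {E' : Type*} [NormedAddCommGroup E'] [NormedSpace ℝ E'] [FiniteDimensional ℝ E']
    {H' : Type*} [TopologicalSpace H'] (J : ModelWithCorners ℝ E' H') [J.Boundaryless]
    {G : Type*} [TopologicalSpace G] [ChartedSpace H G] [IsManifold I ∞ G] [T2Space G]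
    {M : Type*} [TopologicalSpace M] [ChartedSpace H' M] [IsManifold J ∞ M] [T2Space M]
    (𝒢 : LieGroupoid I J G M) :
    ∃ φ : 𝒢.leftInvariantForms 2 ≃ₗ[ℝ] 𝒢.algebroidForms 2,
      (∀ (α : 𝒢.leftInvariantForms 2) (p : M), (φ α).1 p = α.1 (𝒢.unit p)) ∧
      (∀ α : 𝒢.leftInvariantForms 2, 𝒢.IsTSymplectic α ↔ 𝒢.IsQuasiFrobenius (φ α)) ∧
      Set.BijOn φ {α | 𝒢.IsTSymplectic α} {α | 𝒢.IsQuasiFrobenius α} := by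
  let φ : 𝒢.leftInvariantForms 2 ≃ₗ[ℝ] 𝒢.algebroidForms 2 :=
    LinearEquiv.ofBijective (𝒢.restrictUnits 2)
      ⟨LieGroupoid.restrictUnits_injective, LieGroupoid.restrictUnits_surjective⟩
  have hφ : ∀ α : 𝒢.leftInvariantForms 2, 𝒢.IsTSymplectic α ↔ 𝒢.IsQuasiFrobenius (φ α) :=
    fun α ↦ LieGroupoid.isTSymplectic_iff_isQuasiFrobenius α
  refine ⟨φ, fun _ _ ↦ rfl, hφ, fun α h ↦ (hφ α).1 h, φ.injective.injOn, fun β h ↦ ?_⟩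
  refine ⟨φ.symm β, (hφ _).2 ?_, φ.apply_symm_apply β⟩
  rwa [φ.apply_symm_apply]
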